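/- **Theorem (strong completeness of FOFS-D with respect to serial frames).** Let $\sigma$ be a signature consisting of a countably infinite set of constants and a countable set of predicate symbols of positive arity. Formulas are built from atoms $P(t_1,\dots,t_n)$ and $s\equiv t$ (terms are constants or variables $v_0,v_1,\dots$) and $\bot$ by $\land,\lor,\to,\Box,\Diamond,\forall x,\exists x$, with $\neg\varphi:=\varphi\to\bot$ and $\top:=\neg\bot$. Let $\Gamma$ be a set of sentences and $\varphi$ a sentence. If $\Gamma\Vdash\varphi$ over all FOFS models whose modal relation is serial, then $\Gamma\vdash\varphi$ in FOFS-D. *The logic.* The theorems of FOFS-D are the sentences generated as follows, where $\varphi,\psi$ are sentences, $\varphi(x),\psi(x)$ are formulas with no free variable other than $x$, and $c,c_1,c_2$ are constants. Axioms: substitution instances (by sentences) of theorems of intuitionistic propositional logic; $\Box(\varphi\land\psi)\leftrightarrow(\Box\varphi\land\Box\psi)$; $\Box\top$; $\Diamond(\varphi\lor\psi)\leftrightarrow(\Diamond\varphi\lor\Diamond\psi)$; $\neg\Diamond\bot$; $(\Diamond\varphi\to\Box\psi)\to\Box(\varphi\to\psi)$; $\Diamond(\varphi\to\psi)\to(\Box\varphi\to\Diamond\psi)$;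 $\forall x\varphi(x)\to\varphi(c)$; $\varphi(c)\to\exists x\varphi(x)$; $\forall x(\varphi(x)\to\psi)\to(\exists x\varphi(x)\to\psi)$; $\forall x(\varphi\to\psi(x))\to(\varphi\to\forall x\psi(x))$; $c\equiv c$; $c_1\equiv c_2\to(\varphi(c_1)\to\varphi(c_2))$ for $\varphi(x)$ without $\Box,\Diamond$; and $\Box\varphi\to\Diamond\varphi$. Rules: modus ponens; from $\varphi(c)$ infer $\forall x\varphi(x)$ if $c$ does not occur in $\varphi(x)$; from $\varphi\to\psi$ infer $\Box\varphi\to\Box\psi$ and $\Diamond\varphi\to\Diamond\psi$. We write $\Gamma\vdash\varphi$ if $\bigwedge_i\gamma_i\to\varphi$ is a theorem for some finite list of sentences $\gamma_i\in\Gamma$. *Models.* An FOFS frame consists of a set $W$, a partial order $\preccurlyeq$ and a relation $M$ on $W$ such that (FC1) if $w\,M\,v\preccurlyeq v'$ then there is $w'$ with $w\preccurlyeq w'\,M\,v'$, and (FC2) if $w\preccurlyeq w'$ and $w\,M\,v$ then there is $v'$ with $v\preccurlyeq v'$ and $w'\,M\,v'$; sets $D(w)$ for $w\in W$ that grow along both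 $\preccurlyeq$ and $M$; and equivalence relations $\sim_w$ on $D(w)$ that grow along $\preccurlyeq$. A model adds, for each constant $c$, an element $I(c)$ lying in every $D(w)$, and for each $n$-ary $P$ and each $w$ a set $I_w(P)\subseteq D(w)^n$ that grows along $\preccurlyeq$ and is closed under $\sim_w$ coordinatewise. The modal relation is serial if every $w$ has some $v$ with $w\,M\,v$. For $g$ an assignment of elements of $D(w)$ to the variables, truth $w\Vdash_g\varphi$ is defined by: $w\Vdash_g P(\bar t)$ iff the denotation of $\bar t$ is in $I_w(P)$; $w\Vdash_g s\equiv t$ iff the denotations are $\sim_w$-equivalent; the usual clauses at $w$ for $\land,\lor,\bot$; $w\Vdash_g\varphi\to\psi$ iff for all $w'\succcurlyeq w$, $w'\not\Vdash_g\varphi$ or $w'\Vdash_g\psi$; $w\Vdash_g\Box\varphi$ iff $v'\Vdash_g\varphi$ whenever $w\preccurlyeq w'\,M\,v'$; $w\Vdash_g\Diamond\varphi$ iff $v\Vdash_g\varphi$ for some $v$ with $w\,M\,v$; $w\Vdash_g\forall x\varphi$ iff $w'\Vdash_{g[x:=a]}\varphi$ for all $w'\succcurlyeq w$ and $a\in D(w')$;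 $w\Vdash_g\exists x\varphi$ iff $w\Vdash_{g[x:=a]}\varphi$ for some $a\in D(w)$. A sentence is true at $w$ if it is true there under every such $g$. Finally, $\Gamma\Vdash\varphi$ over a class of models means that at every world of every model of the class at which all members of $\Gamma$ are true, $\varphi$ is true. -/

import Mathlib

universe u

namespace FOFS

/-- A signature: a countably infinite set of constants and a countable set of predicate symbols
with positive arities. -/
structure Signature where
  Const : Type u
  Pred : Type u
  arity : Pred → ℕ
  arity_pos : ∀ P, 0 < arity P
  const_countable : Countable Const
  const_infinite : Infinite Const
  pred_countable : Countable Pred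

/-- Terms: variables `v₀, v₁, …` and constants. -/
inductive Term (σ : Signature.{u}) : Type u
  | var (x : ℕ) : Term σ
  | const (c : σ.Const) : Term σ

inductive Formula (σ : Signature.{u}) : Type u
  | rel (P : σ.Pred) (ts : Fin (σ.arity P) → Term σ) : Formula σ
  | eq (s t : Term σ) : Formula σ
  | and (φ ψ : Formula σ) : Formula σ
  | or (φ ψ : Formula σ) : Formula σ
  | imp (φ ψ : Formula σ) : Formula σ
  | box (φ : Formula σ) : Formula σ
  | dia (φ : Formula σ) : Formula σ
  | all (x : ℕ) (φ : Formula σ) : Formula σ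
  | ex (x : ℕ) (φ : Formula σ) : Formula σ
  | bot : Formula σ

namespace Term

variable {σ : Signature.{u}}

def vars : Term σ → Set ℕ
  | var x => {x}
  | const _ => ∅

def consts : Term σ → Set σ.Const
  | var _ => ∅
  | const c => {c}

/-- Replace the variable `x` by the constant `c`. -/
def inst (x : ℕ) (c : σ.Const) : Term σ → Term σ
  | var y => if y = x then const c else var y
  | const d => const d

end Term

namespace Formula

variable {σ : Signature.{u}}

def neg (φ : Formula σ) : Formula σ := imp φ bot

def top : Formula σ := neg bot

def iff (φ ψ : Formula σ) : Formula σ := and (imp φ ψ) (imp ψ φ)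

def freeVars : Formula σ → Set ℕ
  | rel _ ts => ⋃ i, (ts i).vars
  | eq s t => s.vars ∪ t.vars
  | and φ ψ => φ.freeVars ∪ ψ.freeVars
  | or φ ψ => φ.freeVars ∪ ψ.freeVars
  | imp φ ψ => φ.freeVars ∪ ψ.freeVars
  | box φ => φ.freeVars
  | dia φ => φ.freeVars
  | all x φ => φ.freeVars \ {x}
  | ex x φ => φ.freeVars \ {x}
  | bot => ∅

def consts : Formula σ → Set σ.Const
  | rel _ ts => ⋃ i, (ts i).consts
  | eq s t => s.consts ∪ t.consts
  | and φ ψ => φ.consts ∪ ψ.consts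
  | or φ ψ => φ.consts ∪ ψ.consts
  | imp φ ψ => φ.consts ∪ ψ.consts
  | box φ => φ.consts
  | dia φ => φ.consts
  | all _ φ => φ.consts
  | ex _ φ => φ.consts
  | bot => ∅

/-- Replace every free occurrence of the variable `x` by the constant `c`. -/
def inst (x : ℕ) (c : σ.Const) : Formula σ → Formula σ
  | rel P ts => rel P fun i => (ts i).inst x c
  | eq s t => eq (s.inst x c) (t.inst x c)
  | and φ ψ => and (φ.inst x c) (ψ.inst x c)
  | or φ ψ => or (φ.inst x c) (ψ.inst x c)
  | imp φ ψ => imp (φ.inst x c) (ψ.inst x c)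
  | box φ => box (φ.inst x c)
  | dia φ => dia (φ.inst x c)
  | all y φ => if y = x then all y φ else all y (φ.inst x c)
  | ex y φ => if y = x then ex y φ else ex y (φ.inst x c)
  | bot => bot

def ModalFree : Formula σ → Prop
  | rel _ _ => True
  | eq _ _ => True
  | and φ ψ => φ.ModalFree ∧ ψ.ModalFree
  | or φ ψ => φ.ModalFree ∧ ψ.ModalFree
  | imp φ ψ => φ.ModalFree ∧ ψ.ModalFree
  | box _ => False
  | dia _ => False
  | all _ φ => φ.ModalFree
  | ex _ φ => φ.ModalFree
  | bot => True

def IsSentence (φ : Formula σ) : Prop := φ.freeVars = ∅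

/-- `φ = φ(x)` has no free variable other than `x` (`x` need not occur, so that the quantifier
axioms and rules also govern vacuous quantification). -/
def OnePlace (x : ℕ) (φ : Formula σ) : Prop := φ.freeVars ⊆ {x}

/-- The conjunction of a finite list of formulas. -/
def conj : List (Formula σ) → Formula σ
  | [] => top
  | φ :: l => and φ (conj l)

end Formula

/-- Formulas of intuitionistic propositional logic. -/
inductive PropFormula : Type
  | atom (n : ℕ) : PropFormula
  | and (a b : PropFormula) : PropFormula
  | or (a b : PropFormula) : PropFormula
  | imp (a b : PropFormula) : PropFormula
  | bot : PropFormula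

/-- Substitution of formulas of the first-order modal language for propositional atoms. -/
def PropFormula.subst {σ : Signature.{u}} (s : ℕ → Formula σ) : PropFormula → Formula σ
  | atom n => s n
  | and a b => .and (a.subst s) (b.subst s)
  | or a b => .or (a.subst s) (b.subst s)
  | imp a b => .imp (a.subst s) (b.subst s)
  | bot => .bot

open PropFormula in
/-- Theorems of the intuitionistic propositional calculus, by the usual Hilbert system. -/
inductive IPC : PropFormula → Prop
  | k (a b) : IPC (imp a (imp b a))
  | s (a b c) : IPC (imp (imp a (imp b c)) (imp (imp a b) (imp a c)))
  | andLeft (a b) : IPC (imp (and a b) a)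
  | andRight (a b) : IPC (imp (and a b) b)
  | andIntro (a b) : IPC (imp a (imp b (and a b)))
  | orLeft (a b) : IPC (imp a (or a b))
  | orRight (a b) : IPC (imp b (or a b))
  | orElim (a b c) : IPC (imp (imp a c) (imp (imp b c) (imp (or a b) c)))
  | botElim (a) : IPC (imp bot a)
  | mp {a b} : IPC (imp a b) → IPC a → IPC b

open Formula in
/-- Theorems of the logic `FOFS ⊕ A`, where `A` is a set of additional axioms.  In `gen`, the
formula `φ` is what results from `φ(c)` by replacing *every* occurrence of `c` by `x`, no such
occurrence lying in the scope of a quantifier that binds `x`. -/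
inductive Provable {σ : Signature.{u}} (A : Set (Formula σ)) : Formula σ → Prop
  | extra {φ} : φ ∈ A → Provable A φ
  | int {a : PropFormula} {s : ℕ → Formula σ} :
      IPC a → (∀ n, IsSentence (s n)) → Provable A (a.subst s)
  | boxAnd {φ ψ} : IsSentence φ → IsSentence ψ →
      Provable A (iff (box (and φ ψ)) (and (box φ) (box ψ)))
  | boxTop : Provable A (box top)
  | diaOr {φ ψ} : IsSentence φ → IsSentence ψ →
      Provable A (iff (dia (or φ ψ)) (or (dia φ) (dia ψ)))
  | diaBot : Provable A (neg (dia bot))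
  | fs1 {φ ψ} : IsSentence φ → IsSentence ψ →
      Provable A (imp (imp (dia φ) (box ψ)) (box (imp φ ψ)))
  | fs2 {φ ψ} : IsSentence φ → IsSentence ψ →
      Provable A (imp (dia (imp φ ψ)) (imp (box φ) (dia ψ)))
  | univ {x φ} (c : σ.Const) : OnePlace x φ → Provable A (imp (all x φ) (φ.inst x c))
  | exist {x φ} (c : σ.Const) : OnePlace x φ → Provable A (imp (φ.inst x c) (ex x φ))
  | allAnt {x φ ψ} : OnePlace x φ → IsSentence ψ →
      Provable A (imp (all x (imp φ ψ)) (imp (ex x φ) ψ))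
  | allCon {x φ ψ} : IsSentence φ → OnePlace x ψ →
      Provable A (imp (all x (imp φ ψ)) (imp φ (all x ψ)))
  | idRef (c : σ.Const) : Provable A (eq (.const c) (.const c))
  | idSub {x φ} (c₁ c₂ : σ.Const) : OnePlace x φ → ModalFree φ →
      Provable A (imp (eq (.const c₁) (.const c₂)) (imp (φ.inst x c₁) (φ.inst x c₂)))
  | mp {φ ψ} : Provable A (imp φ ψ) → Provable A φ → Provable A ψ
  | gen {x φ} {c : σ.Const} : OnePlace x φ → c ∉ φ.consts →
      Provable A (φ.inst x c) → Provable A (all x φ)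
  | regBox {φ ψ} : Provable A (imp φ ψ) → Provable A (imp (box φ) (box ψ))
  | regDia {φ ψ} : Provable A (imp φ ψ) → Provable A (imp (dia φ) (dia ψ))

/-- `Γ ⊢ φ` in `FOFS ⊕ A`: some finite conjunction of members of `Γ` provably implies `φ`. -/
def Derives {σ : Signature.{u}} (A : Set (Formula σ)) (Γ : Set (Formula σ)) (φ : Formula σ) :
    Prop :=
  ∃ l : List (Formula σ), (∀ γ ∈ l, γ ∈ Γ) ∧ Provable A (.imp (Formula.conj l) φ)

/-- The instances `□φ → ◇φ`, for sentences `φ`. -/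
def axiomD (σ : Signature.{u}) : Set (Formula σ) :=
  {χ | ∃ φ : Formula σ, φ.IsSentence ∧ χ = .imp (.box φ) (.dia φ)}

/-- Fischer Servi frames. -/
structure FSFrame where
  World : Type u
  le : World → World → Prop
  acc : World → World → Prop
  le_refl : ∀ w, le w w
  le_trans : ∀ w w' w'', le w w' → le w' w'' → le w w''
  le_antisymm : ∀ w w', le w w' → le w' w → w = w'
  fc1 : ∀ w v v', acc w v → le v v' → ∃ w', le w w' ∧ acc w' v'
  fc2 : ∀ w w' v, le w w' → acc w v → ∃ v', le v v' ∧ acc w' v'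

/-- `FOFS` frames: Fischer Servi frames with a domain system.  All the domains are subsets of an
ambient type `Elem`, and `eqv w` is an equivalence relation on the set `dom w`. -/
structure Frame extends FSFrame.{u} where
  Elem : Type u
  dom : World → Set Elem
  dom_le : ∀ w w', le w w' → dom w ⊆ dom w'
  dom_acc : ∀ w v, acc w v → dom w ⊆ dom v
  eqv : World → Elem → Elem → Prop
  eqv_dom : ∀ w a b, eqv w a b → a ∈ dom w ∧ b ∈ dom w
  eqv_refl : ∀ w, ∀ a ∈ dom w, eqv w a a
  eqv_symm : ∀ w a b, eqv w a b → eqv w b a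
  eqv_trans : ∀ w a b c, eqv w a b → eqv w b c → eqv w a c
  eqv_le : ∀ w w' a b, le w w' → eqv w a b → eqv w' a b

/-- The modal relation of the frame is serial. -/
def Frame.Serial (F : Frame.{u}) : Prop := ∀ w, ∃ v, F.acc w v

/-- `FOFS` models over a signature: `FOFS` frames with an interpretation. -/
structure Model (σ : Signature.{u}) extends Frame.{u} where
  cst : σ.Const → Elem
  cst_mem : ∀ c w, cst c ∈ dom w
  rel : World → (P : σ.Pred) → Set (Fin (σ.arity P) → Elem)
  rel_dom : ∀ w P, ∀ a ∈ rel w P, ∀ i, a i ∈ dom w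
  rel_le : ∀ w w' P, le w w' → rel w P ⊆ rel w' P
  rel_eqv : ∀ w P a b, (∀ i, eqv w (a i) (b i)) → a ∈ rel w P → b ∈ rel w P

namespace Model

variable {σ : Signature.{u}} (M : Model σ)

/-- Denotation of a term under a variable assignment. -/
def den (g : ℕ → M.Elem) : Term σ → M.Elem
  | .var x => g x
  | .const c => M.cst c

/-- `g` is a `w`-variable assignment. -/
def IsAssignment (w : M.World) (g : ℕ → M.Elem) : Prop := ∀ x, g x ∈ M.dom w

/-- Truth of a formula at a world relative to an assignment. -/
def Sat : M.World → (ℕ → M.Elem) → Formula σ → Prop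
  | w, g, .rel P ts => (fun i => M.den g (ts i)) ∈ M.rel w P
  | w, g, .eq s t => M.eqv w (M.den g s) (M.den g t)
  | w, g, .and φ ψ => Sat w g φ ∧ Sat w g ψ
  | w, g, .or φ ψ => Sat w g φ ∨ Sat w g ψ
  | w, g, .imp φ ψ => ∀ w', M.le w w' → Sat w' g φ → Sat w' g ψ
  | w, g, .box φ => ∀ w' v', M.le w w' → M.acc w' v' → Sat v' g φ
  | w, g, .dia φ => ∃ v, M.acc w v ∧ Sat v g φ
  | w, g, .all x φ => ∀ w', M.le w w' → ∀ a ∈ M.dom w', Sat w' (Function.update g x a) φ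
  | w, g, .ex x φ => ∃ a ∈ M.dom w, Sat w (Function.update g x a) φ
  | _, _, .bot => False

/-- Truth at a world: truth under all `w`-variable assignments. -/
def TrueAt (w : M.World) (φ : Formula σ) : Prop := ∀ g, M.IsAssignment w g → M.Sat w g φ

end Model

/-- Local semantic consequence over the class of models whose frame satisfies `C`. -/
def Entails {σ : Signature.{u}} (C : Frame.{u} → Prop) (Γ : Set (Formula σ)) (φ : Formula σ) :
    Prop :=
  ∀ M : Model σ, C M.toFrame → ∀ w : M.World, (∀ γ ∈ Γ, M.TrueAt w γ) → M.TrueAt w φ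

end FOFS

/-!
The worlds of the canonical model are finite chains `T 0, …, T k` of saturated theories, each one a
modal successor of the preceding one.  Single theories would not do: by `fc1` a proper extension of
a modal successor of `w` needs a modal predecessor extending `w`, and a chain brings its
predecessors along.  Constants carry a level and a stage; the language of `T i` at stage `N`
consists of the constants of level at most `i` and stage at most `N`, so that infinitely many fresh
constants remain for witnesses, and proper extensions raise the stage, which makes the order
antisymmetric.

To refute an implication, a box or a universal sentence in `T k`, one has to extend the whole chain
while its last theory omits an ideal `O` of sentences.  The ideal is pulled back along the chain to
the sentences that imply some `□χ` with `χ ∈ O`.  The extension of `T (k - 1)` is chosen maximal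
among the theories omitting the pulled back ideal: by `(◇δ → □χ) → □(δ → χ)` every extension of
`T k` that contains what is now necessary and omits `O` is then a modal successor of it.  Condition
`fc2` follows by interpolation over the common language.
-/

namespace FOFS

variable {σ : Signature.{u}}

/-! ### Substitution and renaming of constants -/

namespace Term

/-- Simultaneously rename the constants by `f` and replace each variable in the domain of the
partial assignment `e` by its value. -/
def close (f : σ.Const → σ.Const) (e : ℕ → Option σ.Const) : Term σ → Term σ
  | var x => (e x).elim (var x) const
  | const c => const (f c)

theorem consts_finite (t : Term σ) : t.consts.Finite := by
  cases t <;> simp [consts]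

theorem inst_eq_close (x : ℕ) (c : σ.Const) (t : Term σ) :
    t.inst x c = t.close id (Function.update (fun _ => none) x (some c)) := by
  cases t with
  | var y => by_cases h : y = x <;> simp [inst, close, h]
  | const d => rfl

theorem close_id (t : Term σ) : t.close id (fun _ => none) = t := by
  cases t <;> rfl

theorem close_close (f g : σ.Const → σ.Const) (e e' : ℕ → Option σ.Const) (t : Term σ) :
    (t.close f e).close g e' = t.close (g ∘ f) (fun x => ((e x).map g).or (e' x)) := by
  cases t with
  | var x => cases h : e x <;> simp [close, h]
  | const c => rfl

theorem close_congr {f f' : σ.Const → σ.Const} {e e' : ℕ → Option σ.Const} {t : Term σ}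
    (hf : ∀ c ∈ t.consts, f c = f' c) (he : ∀ x ∈ t.vars, e x = e' x) :
    t.close f e = t.close f' e' := by
  cases t with
  | var x => simp [close, he x rfl]
  | const c => simp [close, hf c rfl]

theorem vars_close (f : σ.Const → σ.Const) (e : ℕ → Option σ.Const) (t : Term σ) :
    (t.close f e).vars = t.vars ∩ {x | e x = none} := by
  cases t with
  | var x => cases h : e x <;> ext y <;> simp +contextual [close, vars, h]
  | const c => simp [close, vars]

theorem consts_close (f : σ.Const → σ.Const) (e : ℕ → Option σ.Const) (t : Term σ) :
    (t.close f e).consts = f '' t.consts ∪ {c | ∃ x ∈ t.vars, e x = some c} := by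
  cases t with
  | var x => cases h : e x <;> ext c <;> simp [close, vars, consts, h, eq_comm]
  | const c => simp [close, vars, consts]

theorem eventually_exists_eq_inst (c : σ.Const) (t : Term σ) :
    ∀ᶠ x in Filter.atTop, ∃ s : Term σ, s.inst x c = t ∧ c ∉ s.consts := by
  cases t with
  | var y =>
    filter_upwards [Filter.eventually_ne_atTop y] with x hx
    exact ⟨var y, by simp [inst, hx.symm], by simp [consts]⟩
  | const d =>
    refine Filter.Eventually.of_forall fun x => ?_
    by_cases h : d = c
    · exact ⟨var x, by simp [inst, h], by simp [consts]⟩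
    · exact ⟨const d, rfl, by simpa [consts] using Ne.symm h⟩

end Term

namespace Formula

/-- Simultaneously rename the constants by `f` and replace each free occurrence of a variable in
the domain of the partial assignment `e` by its value. -/
def close (f : σ.Const → σ.Const) : (ℕ → Option σ.Const) → Formula σ → Formula σ
  | e, rel P ts => rel P fun i => (ts i).close f e
  | e, eq s t => eq (s.close f e) (t.close f e)
  | e, and φ ψ => and (φ.close f e) (ψ.close f e)
  | e, or φ ψ => or (φ.close f e) (ψ.close f e)
  | e, imp φ ψ => imp (φ.close f e) (ψ.close f e)
  | e, box φ => box (φ.close f e)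
  | e, dia φ => dia (φ.close f e)
  | e, all x φ => all x (φ.close f (Function.update e x none))
  | e, ex x φ => ex x (φ.close f (Function.update e x none))
  | _, bot => bot

/-- Rename the constants by `f`. -/
abbrev rename (f : σ.Const → σ.Const) (φ : Formula σ) : Formula σ := φ.close f fun _ => none

theorem consts_finite (φ : Formula σ) : φ.consts.Finite := by
  induction φ with
  | rel P ts => exact Set.finite_iUnion fun i => (ts i).consts_finite
  | eq s t => exact s.consts_finite.union t.consts_finite
  | and φ ψ h h' | or φ ψ h h' | imp φ ψ h h' => exact h.union h'
  | box _ h | dia _ h | all _ _ h | ex _ _ h => exact h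
  | bot => exact Set.finite_empty

theorem close_id (φ : Formula σ) : φ.close id (fun _ => none) = φ := by
  induction φ <;> simp_all [close, Term.close_id]

theorem inst_eq_close (x : ℕ) (c : σ.Const) (φ : Formula σ) :
    φ.inst x c = φ.close id (Function.update (fun _ => none) x (some c)) := by
  induction φ with
  | all y φ h | ex y φ h =>
    by_cases hy : y = x
    · simp [inst, close, hy, close_id]
    · simp only [inst, if_neg hy, h, close]
      rw [Function.update_comm (Ne.symm hy), Function.update_eq_self y fun _ => none]
  | _ => simp_all [inst, close, Term.inst_eq_close]

theorem close_close (f g : σ.Const → σ.Const) (e e' : ℕ → Option σ.Const) (φ : Formula σ) :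
    (φ.close f e).close g e' = φ.close (g ∘ f) (fun x => ((e x).map g).or (e' x)) := by
  induction φ generalizing e e' with
  | all y φ h | ex y φ h =>
    simp only [close, h]
    congr 2
    ext1 x
    by_cases hx : x = y <;> simp [hx]
  | _ => simp_all [close, Term.close_close]

theorem close_congr {f f' : σ.Const → σ.Const} {e e' : ℕ → Option σ.Const} {φ : Formula σ}
    (hf : ∀ c ∈ φ.consts, f c = f' c) (he : ∀ x ∈ φ.freeVars, e x = e' x) :
    φ.close f e = φ.close f' e' := by
  induction φ generalizing e e' with
  | rel P ts =>
    simp only [consts, freeVars, Set.mem_iUnion] at hf he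
    simp only [close]
    congr 1
    funext i
    exact Term.close_congr (fun c hc => hf c ⟨i, hc⟩) (fun x hx => he x ⟨i, hx⟩)
  | eq s t =>
    exact congrArg₂ eq (Term.close_congr (fun c hc => hf c (.inl hc)) fun x hx => he x (.inl hx))
      (Term.close_congr (fun c hc => hf c (.inr hc)) fun x hx => he x (.inr hx))
  | and φ ψ h h' | or φ ψ h h' | imp φ ψ h h' =>
    simp only [close, h (fun c hc => hf c (.inl hc)) fun x hx => he x (.inl hx),
      h' (fun c hc => hf c (.inr hc)) fun x hx => he x (.inr hx)]
  | box φ h | dia φ h => simp only [close, h hf he]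
  | all y φ h | ex y φ h =>
    simp only [close]
    congr 1
    refine h hf fun x hx => ?_
    by_cases hy : x = y
    · simp [hy]
    · simpa [hy] using he x ⟨hx, hy⟩
  | bot => rfl

theorem freeVars_close (f : σ.Const → σ.Const) (e : ℕ → Option σ.Const) (φ : Formula σ) :
    (φ.close f e).freeVars = φ.freeVars ∩ {x | e x = none} := by
  induction φ generalizing e with
  | rel P ts => simp only [close, freeVars, Term.vars_close, Set.iUnion_inter]
  | eq s t => simp only [close, freeVars, Term.vars_close, Set.union_inter_distrib_right]
  | and φ ψ h h' | or φ ψ h h' | imp φ ψ h h' =>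
    simp only [close, freeVars, h, h', Set.union_inter_distrib_right]
  | box φ h | dia φ h => simp only [close, freeVars, h]
  | all y φ h | ex y φ h =>
    ext x
    by_cases hx : x = y <;> simp [close, freeVars, h, hx]
  | bot => simp [close, freeVars]

theorem consts_close (f : σ.Const → σ.Const) (e : ℕ → Option σ.Const) (φ : Formula σ) :
    (φ.close f e).consts = f '' φ.consts ∪ {c | ∃ x ∈ φ.freeVars, e x = some c} := by
  induction φ generalizing e with
  | rel P ts =>
    ext c
    simp only [close, consts, freeVars, Term.consts_close, Set.mem_iUnion, Set.image_iUnion,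
      Set.mem_union, Set.mem_ofPred_eq]
    grind
  | eq s t =>
    ext c
    simp only [close, consts, freeVars, Term.consts_close, Set.image_union, Set.mem_union,
      Set.mem_ofPred_eq]
    grind
  | and φ ψ h h' | or φ ψ h h' | imp φ ψ h h' =>
    ext c
    simp only [close, consts, freeVars, h, h', Set.image_union, Set.mem_union, Set.mem_ofPred_eq]
    grind
  | box φ h | dia φ h => simp only [close, consts, freeVars, h]
  | all y φ h | ex y φ h =>
    simp only [close, consts, freeVars, h]
    congr! 3 with c
    grind
  | bot => simp [close, consts, freeVars]

theorem modalFree_close {f : σ.Const → σ.Const} {e : ℕ → Option σ.Const} {φ : Formula σ} :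
    (φ.close f e).ModalFree ↔ φ.ModalFree := by
  induction φ generalizing e <;> simp_all [close, ModalFree]

/-- The variable can be any one that does not occur in `φ`, not even bound. -/
theorem eventually_exists_eq_inst (c : σ.Const) (φ : Formula σ) :
    ∀ᶠ x in Filter.atTop, ∃ ψ : Formula σ, ψ.inst x c = φ ∧ c ∉ ψ.consts := by
  induction φ with
  | rel P ts =>
    filter_upwards [Filter.eventually_all.2 fun i => (ts i).eventually_exists_eq_inst c] with x h
    choose ts' hts hc using h
    exact ⟨rel P ts', by simp [inst, hts], by simpa [consts] using hc⟩
  | eq s t =>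
    filter_upwards [s.eventually_exists_eq_inst c, t.eventually_exists_eq_inst c]
    rintro x ⟨s, rfl, hs⟩ ⟨t, rfl, ht⟩
    exact ⟨eq s t, rfl, by simp [consts, hs, ht]⟩
  | and φ ψ h h' =>
    filter_upwards [h, h']
    rintro x ⟨φ, rfl, hφ⟩ ⟨ψ, rfl, hψ⟩
    exact ⟨and φ ψ, rfl, by simp [consts, hφ, hψ]⟩
  | or φ ψ h h' =>
    filter_upwards [h, h']
    rintro x ⟨φ, rfl, hφ⟩ ⟨ψ, rfl, hψ⟩
    exact ⟨or φ ψ, rfl, by simp [consts, hφ, hψ]⟩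
  | imp φ ψ h h' =>
    filter_upwards [h, h']
    rintro x ⟨φ, rfl, hφ⟩ ⟨ψ, rfl, hψ⟩
    exact ⟨imp φ ψ, rfl, by simp [consts, hφ, hψ]⟩
  | box φ h => exact h.mono fun x ⟨ψ, hψ, hc⟩ => ⟨box ψ, by simp [inst, hψ], hc⟩
  | dia φ h => exact h.mono fun x ⟨ψ, hψ, hc⟩ => ⟨dia ψ, by simp [inst, hψ], hc⟩
  | all y φ h =>
    filter_upwards [h, Filter.eventually_ne_atTop y]
    rintro x ⟨ψ, rfl, hc⟩ hx
    exact ⟨all y ψ, by simp [inst, hx.symm], hc⟩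
  | ex y φ h =>
    filter_upwards [h, Filter.eventually_ne_atTop y]
    rintro x ⟨ψ, rfl, hc⟩ hx
    exact ⟨ex y ψ, by simp [inst, hx.symm], hc⟩
  | bot => exact Filter.Eventually.of_forall fun x => ⟨bot, rfl, by simp [consts]⟩

theorem inst_of_notMem {x : ℕ} (c : σ.Const) {φ : Formula σ} (h : x ∉ φ.freeVars) :
    φ.inst x c = φ := by
  rw [inst_eq_close, ← φ.close_id, close_close]
  refine close_congr (fun _ _ => rfl) fun y hy => ?_
  simp [show y ≠ x from fun hyx => h (hyx ▸ hy)]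

theorem freeVars_inst (x : ℕ) (c : σ.Const) (φ : Formula σ) :
    (φ.inst x c).freeVars = φ.freeVars \ {x} := by
  rw [inst_eq_close, freeVars_close]
  ext y
  by_cases hy : y = x <;> simp [hy]

theorem consts_inst_subset (x : ℕ) (c : σ.Const) (φ : Formula σ) :
    (φ.inst x c).consts ⊆ insert c φ.consts := by
  rw [inst_eq_close, consts_close, Set.image_id]
  rintro d (hd | ⟨y, -, hd⟩)
  · exact .inr hd
  · by_cases hy : y = x <;> simp_all

theorem consts_subset_inst (x : ℕ) (c : σ.Const) (φ : Formula σ) :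
    φ.consts ⊆ (φ.inst x c).consts := by
  rw [inst_eq_close, consts_close, Set.image_id]
  exact Set.subset_union_left

theorem inst_close (f : σ.Const → σ.Const) {e : ℕ → Option σ.Const} {x : ℕ} (hx : e x = none)
    (c : σ.Const) (φ : Formula σ) :
    (φ.close f e).inst x c = φ.close f (Function.update e x (some c)) := by
  rw [inst_eq_close, close_close]
  refine close_congr (fun _ _ => rfl) fun y _ => ?_
  by_cases hy : y = x <;> simp [hy, hx]

theorem rename_inst (f : σ.Const → σ.Const) (x : ℕ) (c : σ.Const) (φ : Formula σ) :
    (φ.inst x c).rename f = (φ.rename f).inst x (f c) := by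
  rw [inst_close f rfl, inst_eq_close, rename, close_close]
  refine close_congr (fun _ _ => rfl) fun y _ => ?_
  by_cases hy : y = x <;> simp [hy]

theorem rename_rename (f g : σ.Const → σ.Const) (φ : Formula σ) :
    (φ.rename f).rename g = φ.rename (g ∘ f) := close_close _ _ _ _ _

theorem rename_eq_self {f : σ.Const → σ.Const} {φ : Formula σ} (h : ∀ c ∈ φ.consts, f c = c) :
    φ.rename f = φ :=
  (close_congr h fun _ _ => rfl).trans φ.close_id

theorem consts_rename (f : σ.Const → σ.Const) (φ : Formula σ) :
    (φ.rename f).consts = f '' φ.consts := by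
  simp [rename, consts_close]

theorem freeVars_rename (f : σ.Const → σ.Const) (φ : Formula σ) :
    (φ.rename f).freeVars = φ.freeVars := by
  simp [rename, freeVars_close]

theorem rename_all (f : σ.Const → σ.Const) (x : ℕ) (φ : Formula σ) :
    (all x φ).rename f = all x (φ.rename f) := by
  rw [rename, close, Function.update_eq_self x fun _ => none]

theorem rename_ex (f : σ.Const → σ.Const) (x : ℕ) (φ : Formula σ) :
    (ex x φ).rename f = ex x (φ.rename f) := by
  rw [rename, close, Function.update_eq_self x fun _ => none]

theorem rename_imp (f : σ.Const → σ.Const) (φ ψ : Formula σ) :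
    (imp φ ψ).rename f = imp (φ.rename f) (ψ.rename f) := rfl

/-! ### Sentences -/

@[simp] theorem isSentence_and {φ ψ : Formula σ} :
    (and φ ψ).IsSentence ↔ φ.IsSentence ∧ ψ.IsSentence := Set.union_empty_iff

@[simp] theorem isSentence_or {φ ψ : Formula σ} :
    (or φ ψ).IsSentence ↔ φ.IsSentence ∧ ψ.IsSentence := Set.union_empty_iff

@[simp] theorem isSentence_imp {φ ψ : Formula σ} :
    (imp φ ψ).IsSentence ↔ φ.IsSentence ∧ ψ.IsSentence := Set.union_empty_iff

@[simp] theorem isSentence_box {φ : Formula σ} : (box φ).IsSentence ↔ φ.IsSentence := Iff.rfl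

@[simp] theorem isSentence_dia {φ : Formula σ} : (dia φ).IsSentence ↔ φ.IsSentence := Iff.rfl

@[simp] theorem isSentence_bot : (bot : Formula σ).IsSentence := rfl

@[simp] theorem isSentence_neg {φ : Formula σ} : φ.neg.IsSentence ↔ φ.IsSentence := by
  simp [neg]

@[simp] theorem isSentence_top : (top : Formula σ).IsSentence := by simp [top]

@[simp] theorem isSentence_iff {φ ψ : Formula σ} :
    (iff φ ψ).IsSentence ↔ φ.IsSentence ∧ ψ.IsSentence := by
  simp only [iff, isSentence_and, isSentence_imp]
  tauto

@[simp] theorem isSentence_all {x : ℕ} {φ : Formula σ} : (all x φ).IsSentence ↔ OnePlace x φ :=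
  Set.sdiff_eq_empty

@[simp] theorem isSentence_ex {x : ℕ} {φ : Formula σ} : (ex x φ).IsSentence ↔ OnePlace x φ :=
  Set.sdiff_eq_empty

@[simp] theorem isSentence_eq_const (c d : σ.Const) :
    (eq (.const c) (.const d)).IsSentence := Set.union_empty ∅

theorem isSentence_inst_iff {x : ℕ} {φ : Formula σ} {c : σ.Const} :
    (φ.inst x c).IsSentence ↔ OnePlace x φ := by
  rw [IsSentence, freeVars_inst, Set.sdiff_eq_empty, OnePlace]

theorem isSentence_rename {f : σ.Const → σ.Const} {φ : Formula σ} :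
    (φ.rename f).IsSentence ↔ φ.IsSentence := by
  rw [IsSentence, freeVars_rename, IsSentence]

theorem IsSentence.onePlace {φ : Formula σ} (h : φ.IsSentence) (x : ℕ) : OnePlace x φ :=
  h.subset.trans (Set.empty_subset _)

theorem IsSentence.inst {φ : Formula σ} (h : φ.IsSentence) (x : ℕ) (c : σ.Const) :
    φ.inst x c = φ :=
  inst_of_notMem c (h ▸ Set.notMem_empty x)

theorem OnePlace.imp {x : ℕ} {φ ψ : Formula σ} (h : OnePlace x φ) (h' : OnePlace x ψ) :
    OnePlace x (imp φ ψ) := Set.union_subset h h'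

theorem OnePlace.rename {x : ℕ} {φ : Formula σ} (h : OnePlace x φ) (f : σ.Const → σ.Const) :
    OnePlace x (φ.rename f) := by
  rwa [OnePlace, freeVars_rename]

theorem IsSentence.exists_eq_inst {φ : Formula σ} (h : φ.IsSentence) (c : σ.Const) :
    ∃ x ψ, OnePlace x ψ ∧ ψ.inst x c = φ ∧ ψ.consts ⊆ φ.consts \ {c} := by
  obtain ⟨x, ψ, rfl, hc⟩ := (φ.eventually_exists_eq_inst c).exists
  exact ⟨x, ψ, isSentence_inst_iff.1 h, rfl,
    Set.subset_sdiff_singleton (consts_subset_inst x c ψ) hc⟩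

theorem isSentence_conj {l : List (Formula σ)} (h : ∀ φ ∈ l, φ.IsSentence) :
    (conj l).IsSentence := by
  induction l <;> simp_all [conj]

theorem notMem_consts_conj {c : σ.Const} {l : List (Formula σ)} (h : ∀ φ ∈ l, c ∉ φ.consts) :
    c ∉ (conj l).consts := by
  induction l <;> simp_all [conj, consts, top, neg]

end Formula

open Formula

instance : Countable σ.Const := σ.const_countable

instance : Infinite σ.Const := σ.const_infinite

instance : Countable σ.Pred := σ.pred_countable

instance : Countable (Term σ) := by
  have hsurj : (Sum.elim .var .const : ℕ ⊕ σ.Const → Term σ).Surjective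
    | .var x => ⟨.inl x, rfl⟩
    | .const c => ⟨.inr c, rfl⟩
  exact hsurj.countable

theorem exists_countable_closed {α : Type*} {G : Set α} {O : Set (α → α → α)} (hG : G.Countable)
    (hO : O.Countable) :
    ∃ S : Set α, S.Countable ∧ G ⊆ S ∧ ∀ o ∈ O, ∀ a ∈ S, ∀ b ∈ S, o a b ∈ S := by
  let F : ℕ → Set α := fun n => Nat.rec G (fun _ S => S ∪ ⋃ o ∈ O, Set.image2 o S S) n
  have hF : Monotone F := monotone_nat_of_le_succ fun _ => Set.subset_union_left
  have hcount (n : ℕ) : (F n).Countable := by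
    induction n with
    | zero => exact hG
    | succ n ih => exact ih.union (hO.biUnion fun o _ => ih.image2 ih o)
  refine ⟨⋃ n, F n, Set.countable_iUnion hcount, Set.subset_iUnion F 0, fun o ho a ha b hb => ?_⟩
  obtain ⟨m, hm⟩ := Set.mem_iUnion.1 ha
  obtain ⟨n, hn⟩ := Set.mem_iUnion.1 hb
  exact Set.mem_iUnion.2 ⟨max m n + 1, .inr (Set.mem_biUnion ho
    (Set.mem_image2_of_mem (hF (le_max_left m n) hm) (hF (le_max_right m n) hn)))⟩

instance : Countable (Formula σ) := by
  let G : Set (Formula σ) :=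
    {bot} ∪ Set.range (fun a : (P : σ.Pred) × (Fin (σ.arity P) → Term σ) => rel a.1 a.2) ∪
      Set.range fun a : Term σ × Term σ => eq a.1 a.2
  let O : Set (Formula σ → Formula σ → Formula σ) :=
    {.and, .or, .imp, fun φ _ => box φ, fun φ _ => dia φ} ∪
      Set.range (fun x φ _ => all x φ) ∪ Set.range fun x φ _ => ex x φ
  have hG : G.Countable :=
    ((Set.countable_singleton _).union (Set.countable_range _)).union (Set.countable_range _)
  have hO : O.Countable :=
    ((Set.toFinite _).countable.union (Set.countable_range _)).union (Set.countable_range _)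
  obtain ⟨S, hS, hGS, hOS⟩ := exists_countable_closed hG hO
  refine Set.countable_univ_iff.1 (hS.mono fun φ _ => ?_)
  induction φ with
  | rel P ts => exact hGS (.inl (.inr ⟨⟨P, ts⟩, rfl⟩))
  | eq s t => exact hGS (.inr ⟨(s, t), rfl⟩)
  | bot => exact hGS (.inl (.inl rfl))
  | and φ ψ h h' => exact hOS .and (by simp [O]) φ (h trivial) ψ (h' trivial)
  | or φ ψ h h' => exact hOS .or (by simp [O]) φ (h trivial) ψ (h' trivial)
  | imp φ ψ h h' => exact hOS .imp (by simp [O]) φ (h trivial) ψ (h' trivial)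
  | box φ h => exact hOS (fun φ _ => box φ) (by simp [O]) φ (h trivial) φ (h trivial)
  | dia φ h => exact hOS (fun φ _ => dia φ) (by simp [O]) φ (h trivial) φ (h trivial)
  | all x φ h => exact hOS _ (.inl (.inr ⟨x, rfl⟩)) φ (h trivial) φ (h trivial)
  | ex x φ h => exact hOS _ (.inr ⟨x, rfl⟩) φ (h trivial) φ (h trivial)

/-! ### The calculus -/

theorem PropFormula.rename_subst (f : σ.Const → σ.Const) (s : ℕ → Formula σ) (p : PropFormula) :
    (p.subst s).rename f = p.subst fun n => (s n).rename f := by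
  induction p <;> simp_all [PropFormula.subst, Formula.close]

theorem PropFormula.isSentence_subst {s : ℕ → Formula σ} (hs : ∀ n, (s n).IsSentence)
    (p : PropFormula) : (p.subst s).IsSentence := by
  induction p <;> simp_all [PropFormula.subst]

theorem Provable.isSentence {A : Set (Formula σ)} (hA : ∀ φ ∈ A, φ.IsSentence)
    {φ : Formula σ} (h : Provable A φ) : φ.IsSentence := by
  induction h with
  | extra h => exact hA _ h
  | int _ hs => exact PropFormula.isSentence_subst hs _
  | univ c h | exist c h => simp [h, isSentence_inst_iff]
  | allAnt h h' => simp [h, h', h.imp (h'.onePlace _)]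
  | allCon h h' => simp [h, h', (h.onePlace _).imp h']
  | idSub c₁ c₂ h => simp [isSentence_inst_iff, h]
  | gen h => simpa using h
  | _ => simp_all

theorem Provable.rename {A : Set (Formula σ)} (hA : ∀ f, ∀ φ ∈ A, φ.rename f ∈ A)
    {φ : Formula σ} (h : Provable A φ) (f : σ.Const → σ.Const) : Provable A (φ.rename f) := by
  induction h generalizing f with
  | extra h => exact .extra (hA f _ h)
  | int h hs =>
    rw [PropFormula.rename_subst]
    exact .int h fun n => isSentence_rename.2 (hs n)
  | boxAnd h h' => exact .boxAnd (isSentence_rename.2 h) (isSentence_rename.2 h')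
  | boxTop => exact .boxTop
  | diaOr h h' => exact .diaOr (isSentence_rename.2 h) (isSentence_rename.2 h')
  | diaBot => exact .diaBot
  | fs1 h h' => exact .fs1 (isSentence_rename.2 h) (isSentence_rename.2 h')
  | fs2 h h' => exact .fs2 (isSentence_rename.2 h) (isSentence_rename.2 h')
  | univ c h =>
    rw [rename_imp, rename_all, rename_inst]
    exact .univ _ (h.rename f)
  | exist c h =>
    rw [rename_imp, rename_ex, rename_inst]
    exact .exist _ (h.rename f)
  | allAnt h h' =>
    simp only [rename_imp, rename_ex, rename_all]
    exact .allAnt (h.rename f) (isSentence_rename.2 h')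
  | allCon h h' =>
    simp only [rename_imp, rename_all]
    exact .allCon (isSentence_rename.2 h) (h'.rename f)
  | idRef c => exact .idRef _
  | idSub c₁ c₂ h h' =>
    simp only [rename_imp, rename_inst]
    exact .idSub _ _ (h.rename f) (modalFree_close.2 h')
  | mp _ _ h h' => exact .mp (h f) (h' f)
  | @gen x φ c h hc _ ih =>
    classical
    -- `f` may send `c` to a constant of `φ.rename f`, so `c` is first sent to a new constant.
    obtain ⟨d, hd⟩ := (φ.rename f).consts_finite.exists_notMem
    have hφ : φ.rename (Function.update f c d) = φ.rename f :=
      close_congr (fun a ha => Function.update_of_ne (by rintro rfl; exact hc ha) _ _)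
        fun _ _ => rfl
    have hd' := ih (Function.update f c d)
    rw [rename_inst, hφ, Function.update_self] at hd'
    rw [rename_all]
    exact .gen (h.rename f) hd hd'
  | regBox _ ih => exact .regBox (ih f)
  | regDia _ ih => exact .regDia (ih f)

/-- An extension of `FOFS` by sentences whose set is closed under maps of the constants. -/
structure Logic (σ : Signature.{u}) where
  extra : Set (Formula σ)
  isSentence : ∀ φ ∈ extra, φ.IsSentence
  rename_mem : ∀ f, ∀ φ ∈ extra, φ.rename f ∈ extra

/-- The logic `FOFS-D`. -/
def logicD (σ : Signature.{u}) : Logic σ where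
  extra := axiomD σ
  isSentence := by
    rintro _ ⟨φ, hφ, rfl⟩
    simp [hφ]
  rename_mem := by
    rintro f _ ⟨φ, hφ, rfl⟩
    exact ⟨φ.rename f, isSentence_rename.2 hφ, rfl⟩

/-- The sentences that `T` takes to be necessary. -/
def unbox (T : Set (Formula σ)) : Set (Formula σ) := {φ | box φ ∈ T}

/-- Derivability in the logic `L` from those members of `T` that are sentences.  For a set `T` of
sentences it coincides with `Derives`, but it lends itself better to induction. -/
inductive Der (L : Logic σ) (T : Set (Formula σ)) : Formula σ → Prop
  | hyp {φ} : φ ∈ T → φ.IsSentence → Der L T φ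
  | thm {φ} : Provable L.extra φ → Der L T φ
  | mp {φ ψ} : Der L T (imp φ ψ) → Der L T φ → Der L T ψ

namespace Der

variable {L : Logic σ} {S T : Set (Formula σ)} {φ ψ χ : Formula σ}

theorem isSentence (h : Der L T φ) : φ.IsSentence := by
  induction h with
  | hyp _ h => exact h
  | thm h => exact h.isSentence L.isSentence
  | mp _ _ h _ => exact (isSentence_imp.1 h).2

theorem cut (hST : ∀ ψ ∈ S, ψ.IsSentence → Der L T ψ) (h : Der L S φ) : Der L T φ := by
  induction h with
  | hyp h h' => exact hST _ h h'
  | thm h => exact .thm h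
  | mp _ _ h₁ h₂ => exact .mp h₁ h₂

theorem mono (hST : S ⊆ T) (h : Der L S φ) : Der L T φ :=
  h.cut fun _ hψ => .hyp (hST hψ)

theorem weaken (h : Der L T ψ) : Der L (insert φ T) ψ := h.mono (Set.subset_insert _ _)

theorem self (h : φ.IsSentence) : Der L (insert φ T) φ := .hyp (Set.mem_insert _ _) h

theorem provable (h : Der L ∅ φ) : Provable L.extra φ := by
  induction h with
  | hyp h => exact h.elim
  | thm h => exact h
  | mp _ _ h₁ h₂ => exact .mp h₁ h₂

theorem rename (f : σ.Const → σ.Const) (h : Der L T φ) :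
    Der L (Formula.rename f '' T) (φ.rename f) := by
  induction h with
  | hyp h h' => exact .hyp ⟨_, h, rfl⟩ (isSentence_rename.2 h')
  | thm h => exact .thm (h.rename L.rename_mem f)
  | mp _ _ h₁ h₂ => exact h₁.mp h₂

theorem rename_iff {f : σ.Const → σ.Const} (hf : f.Injective) :
    Der L (Formula.rename f '' T) (φ.rename f) ↔ Der L T φ := by
  refine ⟨fun h => ?_, rename f⟩
  obtain ⟨g, hg⟩ := hf.hasLeftInverse
  have hgf : (Formula.rename g : Formula σ → Formula σ) ∘ Formula.rename f = id := by
    funext φ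
    exact (rename_rename f g φ).trans (rename_eq_self fun c _ => hg c)
  have hg' := h.rename g
  rwa [← Set.image_comp, hgf, Set.image_id, ← Function.comp_apply (f := Formula.rename g), hgf]
    at hg'

/-! #### Propositional reasoning -/

/-- The substitution of three formulas for the propositional atoms, which is all that the
intuitionistic schemes need. -/
def atoms (φ ψ χ : Formula σ) : ℕ → Formula σ
  | 0 => φ
  | 1 => ψ
  | _ => χ

theorem int (p : PropFormula) (hp : IPC p) (hφ : φ.IsSentence) (hψ : ψ.IsSentence)
    (hχ : χ.IsSentence) : Der L T (p.subst (atoms φ ψ χ)) :=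
  .thm (.int hp fun
    | 0 => hφ
    | 1 => hψ
    | _ + 2 => hχ)

open PropFormula in
theorem k (hφ : φ.IsSentence) (h : Der L T ψ) : Der L T (.imp φ ψ) :=
  (int _ (.k (atom 0) (atom 1)) h.isSentence hφ hφ).mp h

open PropFormula in
theorem s (h : Der L T (.imp φ (.imp ψ χ))) (h' : Der L T (.imp φ ψ)) : Der L T (.imp φ χ) :=
  have hs := isSentence_imp.1 h.isSentence
  have hs' := isSentence_imp.1 hs.2
  ((int _ (.s (atom 0) (atom 1) (atom 2)) hs.1 hs'.1 hs'.2).mp h).mp h'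

open PropFormula in
theorem imp_self (hφ : φ.IsSentence) : Der L T (.imp φ φ) :=
  have hφφ : (Formula.imp φ φ).IsSentence := isSentence_imp.2 ⟨hφ, hφ⟩
  s (int _ (.k (atom 0) (atom 1)) hφ hφφ hφ) (int _ (.k (atom 0) (atom 1)) hφ hφ hφ)

theorem top : Der L T .top := imp_self isSentence_bot

theorem imp_intro (hφ : φ.IsSentence) (h : Der L (insert φ T) ψ) : Der L T (.imp φ ψ) := by
  induction h with
  | hyp h h' =>
    rcases h with rfl | h
    · exact imp_self hφ
    · exact k hφ (.hyp h h')
  | thm h => exact k hφ (.thm h)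
  | mp _ _ h₁ h₂ => exact s h₁ h₂

theorem imp_elim (h : Der L T (.imp φ ψ)) : Der L (insert φ T) ψ :=
  h.weaken.mp (self (isSentence_imp.1 h.isSentence).1)

theorem imp_trans (h : Der L T (.imp φ ψ)) (h' : Der L T (.imp ψ χ)) : Der L T (.imp φ χ) :=
  imp_intro (isSentence_imp.1 h.isSentence).1 (h'.weaken.mp h.imp_elim)

open PropFormula in
theorem and_left (h : Der L T (.and φ ψ)) : Der L T φ :=
  have hs := isSentence_and.1 h.isSentence
  (int _ (.andLeft (atom 0) (atom 1)) hs.1 hs.2 hs.2).mp h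

open PropFormula in
theorem and_right (h : Der L T (.and φ ψ)) : Der L T ψ :=
  have hs := isSentence_and.1 h.isSentence
  (int _ (.andRight (atom 0) (atom 1)) hs.1 hs.2 hs.2).mp h

open PropFormula in
theorem and_intro (h : Der L T φ) (h' : Der L T ψ) : Der L T (.and φ ψ) :=
  ((int _ (.andIntro (atom 0) (atom 1)) h.isSentence h'.isSentence h'.isSentence).mp h).mp h'

open PropFormula in
theorem or_left (h : Der L T φ) (hψ : ψ.IsSentence) : Der L T (.or φ ψ) :=
  (int _ (.orLeft (atom 0) (atom 1)) h.isSentence hψ hψ).mp h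

open PropFormula in
theorem or_right (hφ : φ.IsSentence) (h : Der L T ψ) : Der L T (.or φ ψ) :=
  (int _ (.orRight (atom 0) (atom 1)) hφ h.isSentence h.isSentence).mp h

open PropFormula in
theorem or_elim (h : Der L T (.imp φ χ)) (h' : Der L T (.imp ψ χ)) :
    Der L T (.imp (.or φ ψ) χ) :=
  have hs := isSentence_imp.1 h.isSentence
  have hs' := isSentence_imp.1 h'.isSentence
  ((int _ (.orElim (atom 0) (atom 1) (atom 2)) hs.1 hs'.1 hs.2).mp h).mp h'

open PropFormula in
theorem bot_elim (h : Der L T .bot) (hφ : φ.IsSentence) : Der L T φ :=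
  (int _ (.botElim (atom 0)) hφ hφ hφ).mp h

theorem conj {l : List (Formula σ)} (h : ∀ φ ∈ l, Der L T φ) : Der L T (conj l) := by
  induction l with
  | nil => exact top
  | cons φ l ih =>
    rw [List.forall_mem_cons] at h
    exact and_intro h.1 (ih h.2)

theorem of_conj {l : List (Formula σ)} (h : Der L T (Formula.conj l)) : ∀ φ ∈ l, Der L T φ := by
  induction l with
  | nil => simp
  | cons φ l ih => exact List.forall_mem_cons.2 ⟨h.and_left, ih h.and_right⟩

/-! #### Compactness -/

theorem exists_of_directed {ι : Type*} [Nonempty ι] {F : ι → Set (Formula σ)}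
    (hF : Directed (· ⊆ ·) F) (h : Der L (⋃ i, F i) φ) : ∃ i, Der L (F i) φ := by
  induction h with
  | hyp h h' =>
    obtain ⟨i, hi⟩ := Set.mem_iUnion.1 h
    exact ⟨i, .hyp hi h'⟩
  | thm h => exact ⟨Classical.arbitrary ι, .thm h⟩
  | mp _ _ ih ih' =>
    obtain ⟨i, hi⟩ := ih
    obtain ⟨j, hj⟩ := ih'
    obtain ⟨k, hik, hjk⟩ := hF i j
    exact ⟨k, (hi.mono hik).mp (hj.mono hjk)⟩

theorem exists_provable_conj_imp (h : Der L T φ) :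
    ∃ l : List (Formula σ), (∀ γ ∈ l, γ ∈ T ∧ γ.IsSentence) ∧
      Provable L.extra (.imp (Formula.conj l) φ) := by
  suffices ∃ l : List (Formula σ), (∀ γ ∈ l, γ ∈ T ∧ γ.IsSentence) ∧ Der L {γ | γ ∈ l} φ by
    obtain ⟨l, hl, h⟩ := this
    have hs := isSentence_conj fun γ hγ => (hl γ hγ).2
    exact ⟨l, hl, provable (imp_intro hs (h.cut fun γ hγ _ => of_conj (self hs) γ hγ))⟩
  induction h with
  | @hyp φ h h' => exact ⟨[φ], by simp [h, h'], .hyp (by simp) h'⟩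
  | thm h => exact ⟨[], by simp, .thm h⟩
  | mp _ _ ih ih' =>
    obtain ⟨l, hl, h⟩ := ih
    obtain ⟨l', hl', h'⟩ := ih'
    exact ⟨l ++ l', List.forall_mem_append.2 ⟨hl, hl'⟩,
      .mp (h.mono fun γ => List.mem_append_left l') (h'.mono fun γ => List.mem_append_right l)⟩

theorem exists_imp_of_union {X Y : Set (Formula σ)} (hY : ∀ χ ∈ Y, χ.IsSentence)
    (htop : .top ∈ Y) (hand : ∀ χ ∈ Y, ∀ χ' ∈ Y, .and χ χ' ∈ Y) (h : Der L (X ∪ Y) φ) :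
    ∃ χ ∈ Y, Der L X (.imp χ φ) := by
  induction h with
  | @hyp φ h h' =>
    rcases h with h | h
    · exact ⟨_, htop, k isSentence_top (.hyp h h')⟩
    · exact ⟨φ, h, imp_self h'⟩
  | thm h => exact ⟨_, htop, k isSentence_top (.thm h)⟩
  | @mp φ ψ _ _ ih ih' =>
    obtain ⟨χ, hχ, h⟩ := ih
    obtain ⟨χ', hχ', h'⟩ := ih'
    have hs : (Formula.and χ χ').IsSentence := isSentence_and.2 ⟨hY χ hχ, hY χ' hχ'⟩
    exact ⟨_, hand χ hχ χ' hχ', imp_intro hs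
      (.mp (h.weaken.mp (self hs).and_left) (h'.weaken.mp (self hs).and_right))⟩

/-! #### Quantifiers -/

theorem gen {x : ℕ} {c : σ.Const} (hφ : OnePlace x φ) (hc : c ∉ φ.consts)
    (hT : ∀ γ ∈ T, c ∉ γ.consts) (h : Der L T (φ.inst x c)) : Der L T (.all x φ) := by
  obtain ⟨l, hl, h⟩ := h.exists_provable_conj_imp
  have hs := isSentence_conj fun γ hγ => (hl γ hγ).2
  have hc' : c ∉ (Formula.conj l).consts := notMem_consts_conj fun γ hγ => hT γ (hl γ hγ).1
  have hall : Provable L.extra (.all x (.imp (Formula.conj l) φ)) := by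
    refine .gen ((hs.onePlace x).imp hφ) (by simp [consts, hc, hc']) (c := c) ?_
    simpa only [inst, hs.inst x c] using h
  exact .mp (.mp (.thm (.allCon hs hφ)) (.thm hall)) (conj fun γ hγ => .hyp (hl γ hγ).1 (hl γ hγ).2)

theorem ex_elim {x : ℕ} {c : σ.Const} (hφ : OnePlace x φ) (hc : c ∉ φ.consts)
    (hc' : c ∉ ψ.consts) (hT : ∀ γ ∈ T, c ∉ γ.consts) (h : Der L T (.imp (φ.inst x c) ψ)) :
    Der L T (.imp (.ex x φ) ψ) := by
  have hψ := (isSentence_imp.1 h.isSentence).2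
  refine .mp (.thm (.allAnt hφ hψ)) (gen (c := c) (hφ.imp (hψ.onePlace x)) ?_ hT ?_)
  · simp [consts, hc, hc']
  · simpa only [inst, hψ.inst x c] using h

theorem ex_intro {x : ℕ} (c : σ.Const) (hφ : OnePlace x φ) :
    Der L T (.imp (φ.inst x c) (.ex x φ)) := .thm (.exist c hφ)

/-! #### Modalities -/

theorem box_mono (h : Der L ∅ (.imp φ ψ)) : Der L T (.imp (.box φ) (.box ψ)) :=
  .thm (.regBox h.provable)

theorem dia_mono (h : Der L ∅ (.imp φ ψ)) : Der L T (.imp (.dia φ) (.dia ψ)) :=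
  .thm (.regDia h.provable)

theorem nec (h : Der L ∅ φ) : Der L T (.box φ) :=
  (box_mono (k isSentence_top h)).mp (.thm .boxTop)

theorem box_and (h : Der L T (.box φ)) (h' : Der L T (.box ψ)) : Der L T (.box (.and φ ψ)) :=
  (and_right (.thm (.boxAnd (isSentence_box.1 h.isSentence) (isSentence_box.1 h'.isSentence)))).mp
    (and_intro h h')

theorem box_mp (h : Der L T (.box (.imp φ ψ))) (h' : Der L T (.box φ)) : Der L T (.box ψ) :=
  have hs : (Formula.and (.imp φ ψ) φ).IsSentence := isSentence_and.2 ⟨h.isSentence, h'.isSentence⟩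
  (box_mono (imp_intro hs ((self hs).and_left.mp (self hs).and_right))).mp (box_and h h')

theorem box_of_unbox (h : Der L (unbox T) φ) : Der L T (.box φ) := by
  induction h with
  | hyp h h' => exact .hyp h h'
  | thm h => exact nec (.thm h)
  | mp _ _ h₁ h₂ => exact box_mp h₁ h₂

theorem dia_mp (h : Der L T (.dia (.imp φ ψ))) (h' : Der L T (.box φ)) : Der L T (.dia ψ) :=
  have hs := isSentence_imp.1 (isSentence_dia.1 h.isSentence)
  ((Der.thm (.fs2 hs.1 hs.2)).mp h).mp h'

theorem dia_box_mp (h : Der L T (.dia φ)) (h' : Der L T (.box (.imp φ ψ))) :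
    Der L T (.dia ψ) := by
  have hφ : φ.IsSentence := h.isSentence
  have hs : (Formula.imp φ ψ).IsSentence := h'.isSentence
  have hmp : Der L ∅ (.imp φ (.imp (.imp φ ψ) ψ)) :=
    imp_intro hφ (imp_intro hs ((self hs).mp (self hφ).weaken))
  exact dia_mp ((dia_mono hmp).mp h) h'

end Der

theorem derives_iff_der {L : Logic σ} {T : Set (Formula σ)} (hT : ∀ γ ∈ T, γ.IsSentence)
    {φ : Formula σ} : Derives L.extra T φ ↔ Der L T φ := by
  constructor
  · rintro ⟨l, hl, h⟩
    exact .mp (.thm h) (.conj fun γ hγ => .hyp (hl γ hγ) (hT γ (hl γ hγ)))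
  · intro h
    obtain ⟨l, hl, h⟩ := h.exists_provable_conj_imp
    exact ⟨l, fun γ hγ => (hl γ hγ).1, h⟩

/-! ### Saturated theories -/

/-- The sentences of the language whose constants are those in `C`. -/
def sentences (C : Set σ.Const) : Set (Formula σ) := {φ | φ.IsSentence ∧ φ.consts ⊆ C}

section Sentences

variable {C C' : Set σ.Const} {φ ψ : Formula σ}

theorem sentences_mono (h : C ⊆ C') : (sentences C : Set (Formula σ)) ⊆ sentences C' :=
  fun _ hφ => ⟨hφ.1, hφ.2.trans h⟩

theorem and_mem_sentences : .and φ ψ ∈ sentences C ↔ φ ∈ sentences C ∧ ψ ∈ sentences C := by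
  simp only [sentences, Set.mem_ofPred_eq, isSentence_and, consts, Set.union_subset_iff]
  tauto

theorem or_mem_sentences : .or φ ψ ∈ sentences C ↔ φ ∈ sentences C ∧ ψ ∈ sentences C := by
  simp only [sentences, Set.mem_ofPred_eq, isSentence_or, consts, Set.union_subset_iff]
  tauto

theorem imp_mem_sentences : .imp φ ψ ∈ sentences C ↔ φ ∈ sentences C ∧ ψ ∈ sentences C := by
  simp only [sentences, Set.mem_ofPred_eq, isSentence_imp, consts, Set.union_subset_iff]
  tauto

theorem box_mem_sentences : .box φ ∈ sentences C ↔ φ ∈ sentences C := Iff.rfl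

theorem dia_mem_sentences : .dia φ ∈ sentences C ↔ φ ∈ sentences C := Iff.rfl

theorem all_mem_sentences {x : ℕ} : .all x φ ∈ sentences C ↔ OnePlace x φ ∧ φ.consts ⊆ C :=
  and_congr_left' isSentence_all

theorem ex_mem_sentences {x : ℕ} : .ex x φ ∈ sentences C ↔ OnePlace x φ ∧ φ.consts ⊆ C :=
  and_congr_left' isSentence_ex

theorem bot_mem_sentences : (bot : Formula σ) ∈ sentences C := ⟨rfl, Set.empty_subset _⟩

theorem top_mem_sentences : (top : Formula σ) ∈ sentences C :=
  imp_mem_sentences.2 ⟨bot_mem_sentences, bot_mem_sentences⟩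

theorem inst_mem_sentences {x : ℕ} {c : σ.Const} (hφ : OnePlace x φ) (h : φ.consts ⊆ C)
    (hc : c ∈ C) : φ.inst x c ∈ sentences C :=
  ⟨isSentence_inst_iff.2 hφ, (consts_inst_subset x c φ).trans (Set.insert_subset hc h)⟩

theorem notMem_consts_of_mem_sentences {c : σ.Const} (h : φ ∈ sentences C) (hc : c ∉ C) :
    c ∉ φ.consts := fun h' => hc (h.2 h')

end Sentences

/-- Prime theories in the language with constants `C`, with witnesses in `C`. -/
structure Saturated (L : Logic σ) (C : Set σ.Const) (T : Set (Formula σ)) : Prop where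
  subset : T ⊆ sentences C
  closed : ∀ φ ∈ sentences C, Der L T φ → φ ∈ T
  consistent : bot ∉ T
  prime : ∀ φ ψ, .or φ ψ ∈ T → φ ∈ T ∨ ψ ∈ T
  witness : ∀ x φ, .ex x φ ∈ T → ∃ c ∈ C, φ.inst x c ∈ T

/-- No member of `O` is derivable from `T`. -/
def Omits (L : Logic σ) (T O : Set (Formula σ)) : Prop := ∀ o ∈ O, ¬ Der L T o

/-- `T` omits `O` and is maximal with this property in the language with constants `C`. -/
structure MaxOmits (L : Logic σ) (C : Set σ.Const) (T O : Set (Formula σ)) : Prop where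
  omits : Omits L T O
  exists_imp_mem : ∀ θ ∈ sentences C, θ ∉ T → ∃ o ∈ O, imp θ o ∈ T

/-- Closure under replacing a constant from `S` by an existentially bound variable. -/
def ExClosed (S : Set σ.Const) (O : Set (Formula σ)) : Prop :=
  ∀ c ∈ S, ∀ x φ, OnePlace x φ → c ∉ φ.consts → φ.inst x c ∈ O → ex x φ ∈ O

/-- Sets of sentences that can be omitted by a saturated theory which takes its witnesses
from `S`. -/
structure OmitSet (C S : Set σ.Const) (O : Set (Formula σ)) : Prop where
  subset : O ⊆ sentences C
  nonempty : O.Nonempty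
  or_mem : ∀ o ∈ O, ∀ o' ∈ O, .or o o' ∈ O
  exClosed : ExClosed S O

theorem ExClosed.anti {S S' : Set σ.Const} {O : Set (Formula σ)} (h : ExClosed S O)
    (hS : S' ⊆ S) : ExClosed S' O := fun c hc => h c (hS hc)

theorem ExClosed.exists_sentence {S : Set σ.Const} {O : Set (Formula σ)} (hO : ExClosed S O)
    {χ : Formula σ} (hχ : χ.IsSentence) (h : χ ∈ O) :
    ∃ χ' ∈ O, χ' ∈ sentences (χ.consts \ S) := by
  induction hn : (χ.consts ∩ S).ncard using Nat.strong_induction_on generalizing χ with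
  | _ n ih =>
    rcases (χ.consts ∩ S).eq_empty_or_nonempty with hempty | ⟨c, hc, hcS⟩
    · exact ⟨χ, h, hχ, fun c hc => ⟨hc, fun hcS => Set.notMem_empty c (hempty ▸ ⟨hc, hcS⟩)⟩⟩
    obtain ⟨x, φ, hφ, rfl, hφc⟩ := hχ.exists_eq_inst c
    have hlt : ((ex x φ).consts ∩ S).ncard < n :=
      hn ▸ Set.ncard_lt_ncard ⟨Set.inter_subset_inter_left S (hφc.trans Set.sdiff_subset),
        fun h => (hφc (h ⟨hc, hcS⟩).1).2 rfl⟩ ((φ.inst x c).consts_finite.inter_of_left S)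
    obtain ⟨χ', hχ', h'⟩ := ih _ hlt (isSentence_ex.2 hφ)
      (hO c hcS x φ hφ (fun hcφ => (hφc hcφ).2 rfl) h) rfl
    exact ⟨χ', hχ', sentences_mono (Set.sdiff_subset_sdiff_left (hφc.trans Set.sdiff_subset)) h'⟩

section Lindenbaum

variable {L : Logic σ} {C S : Set σ.Const} {A O T T' : Set (Formula σ)} {θ φ : Formula σ}

theorem OmitSet.omits_insert_witness (hO : OmitSet C S O) {c : σ.Const} (hc : c ∈ S) {x : ℕ}
    (hφ : OnePlace x φ) (hcφ : c ∉ φ.consts) (hT : ∀ γ ∈ T, c ∉ γ.consts)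
    (h : Omits L (insert (ex x φ) T) O) :
    Omits L (insert (φ.inst x c) (insert (ex x φ) T)) O := by
  intro o ho hd
  obtain ⟨y, χ, hχ, rfl, hχc⟩ := (hO.subset ho).1.exists_eq_inst c
  have hcχ : c ∉ χ.consts := fun hc => (hχc hc).2 rfl
  refine h _ (hO.exClosed c hc y χ hχ hcχ ho) (.mp ?_ (.self (isSentence_ex.2 hφ)))
  exact .ex_elim hφ hcφ hcχ (Set.forall_mem_insert.2 ⟨hcφ, hT⟩)
    ((Der.imp_intro (isSentence_inst_iff.2 hφ) hd).imp_trans (.ex_intro c hχ))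

/-- Theories omitting `O` that leave infinitely many constants of `S` available as witnesses. -/
structure Extendable (L : Logic σ) (C S : Set σ.Const) (O T : Set (Formula σ)) : Prop where
  subset : T ⊆ sentences C
  infinite : {c ∈ S | ∀ γ ∈ T, c ∉ γ.consts}.Infinite
  omits : Omits L T O

theorem Extendable.insert_of_omits (hT : Extendable L C S O T) (hφ : φ ∈ sentences C)
    (h : Omits L (insert φ T) O) : Extendable L C S O (insert φ T) where
  subset := Set.insert_subset hφ hT.subset
  infinite := (hT.infinite.sdiff φ.consts_finite).mono fun _ hc =>
    ⟨hc.1.1, Set.forall_mem_insert.2 ⟨hc.2, hc.1.2⟩⟩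
  omits := h

/-- `T` either contains `θ`, together with a witness from `C` if `θ` is existential, or refutes
it relative to `O`. -/
def Decides (L : Logic σ) (C : Set σ.Const) (O T : Set (Formula σ)) (θ : Formula σ) : Prop :=
  (θ ∈ T ∧ ∀ x φ, θ = ex x φ → ∃ c ∈ C, φ.inst x c ∈ T) ∨ ∃ o ∈ O, Der L T (imp θ o)

theorem Decides.mono (h : Decides L C O T θ) (hT : T ⊆ T') : Decides L C O T' θ := by
  rcases h with ⟨hθ, hw⟩ | ⟨o, ho, h⟩
  · refine .inl ⟨hT hθ, fun x φ hx => ?_⟩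
    obtain ⟨c, hc, h⟩ := hw x φ hx
    exact ⟨c, hc, hT h⟩
  · exact .inr ⟨o, ho, h.mono hT⟩

theorem Extendable.exists_decides (hSC : S ⊆ C) (hO : OmitSet C S O) (hT : Extendable L C S O T)
    (hθ : θ ∈ sentences C) : ∃ T', Extendable L C S O T' ∧ T ⊆ T' ∧ Decides L C O T' θ := by
  by_cases hθO : Omits L (insert θ T) O
  swap
  · simp only [Omits, not_forall, not_not] at hθO
    obtain ⟨o, ho, h⟩ := hθO
    exact ⟨T, hT, subset_rfl, .inr ⟨o, ho, .imp_intro hθ.1 h⟩⟩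
  have hT' := hT.insert_of_omits hθ hθO
  by_cases hex : ∃ x φ, θ = ex x φ
  swap
  · exact ⟨_, hT', Set.subset_insert _ _,
      .inl ⟨Set.mem_insert _ _, fun x φ h => (hex ⟨x, φ, h⟩).elim⟩⟩
  obtain ⟨x, φ, rfl⟩ := hex
  obtain ⟨hφ, hφC⟩ := ex_mem_sentences.1 hθ
  obtain ⟨c, hcS, hc⟩ := hT'.infinite.nonempty
  obtain ⟨hcφ, hcT⟩ := Set.forall_mem_insert.1 hc
  have hφc : φ.inst x c ∈ sentences C := inst_mem_sentences hφ hφC (hSC hcS)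
  refine ⟨_, hT'.insert_of_omits hφc (hO.omits_insert_witness hcS hφ hcφ hcT hθO),
    (Set.subset_insert _ _).trans (Set.subset_insert _ _), .inl ⟨by simp, fun y ψ h => ?_⟩⟩
  obtain ⟨rfl, rfl⟩ := (ex.injEq ..).mp h
  exact ⟨c, hSC hcS, Set.mem_insert _ _⟩

theorem Extendable.exists_decides_all (hSC : S ⊆ C) (hO : OmitSet C S O)
    (hA : Extendable L C S O A) :
    ∃ T ⊆ sentences C, A ⊆ T ∧ Omits L T O ∧ ∀ θ ∈ sentences C, Decides L C O T θ := by
  obtain ⟨en, hen⟩ := (sentences C).to_countable.exists_eq_range ⟨bot, bot_mem_sentences⟩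
  have hmem (n : ℕ) : en n ∈ sentences C := hen ▸ Set.mem_range_self n
  choose! next hnext hsub hdec using fun T hT n =>
    Extendable.exists_decides (L := L) (T := T) hSC hO hT (hmem n)
  let G : ℕ → Set (Formula σ) := fun n => Nat.rec A (fun n T => next T n) n
  have hG : ∀ n, Extendable L C S O (G n) := fun n => by
    induction n with
    | zero => exact hA
    | succ n ih => exact hnext _ ih n
  have hmono : Monotone G := monotone_nat_of_le_succ fun n => hsub _ (hG n) n
  refine ⟨⋃ n, G n, Set.iUnion_subset fun n => (hG n).subset, Set.subset_iUnion G 0,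
    fun o ho h => ?_, fun θ hθ => ?_⟩
  · obtain ⟨n, hn⟩ := h.exists_of_directed hmono.directed_le
    exact (hG n).omits o ho hn
  · obtain ⟨n, rfl⟩ := hen ▸ hθ
    exact (hdec _ (hG n) n).mono (Set.subset_iUnion G (n + 1))

theorem mem_of_decides_of_der (hTO : Omits L T O) (hθ : Decides L C O T θ) (h : Der L T θ) :
    θ ∈ T := by
  rcases hθ with h' | ⟨o, ho, h'⟩
  · exact h'.1
  · exact (hTO o ho (h'.mp h)).elim

theorem exists_imp_mem_of_decides (hO : OmitSet C S O) (hTO : Omits L T O)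
    (hdec : ∀ θ ∈ sentences C, Decides L C O T θ) (hθ : θ ∈ sentences C) (h : θ ∉ T) :
    ∃ o ∈ O, imp θ o ∈ T := by
  obtain h' | ⟨o, ho, h'⟩ := hdec θ hθ
  · exact (h h'.1).elim
  · exact ⟨o, ho, mem_of_decides_of_der hTO (hdec _ (imp_mem_sentences.2 ⟨hθ, hO.subset ho⟩)) h'⟩

theorem OmitSet.saturated_of_decides (hO : OmitSet C S O) (hT : T ⊆ sentences C)
    (hTO : Omits L T O) (hdec : ∀ θ ∈ sentences C, Decides L C O T θ) : Saturated L C T where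
  subset := hT
  closed θ hθ h := mem_of_decides_of_der hTO (hdec θ hθ) h
  consistent h := by
    obtain ⟨o, ho⟩ := hO.nonempty
    exact hTO o ho (.bot_elim (.hyp h rfl) (hO.subset ho).1)
  prime φ ψ h := by
    by_contra! hn
    obtain ⟨hφ, hψ⟩ := or_mem_sentences.1 (hT h)
    obtain ⟨o, ho, hφo⟩ := exists_imp_mem_of_decides hO hTO hdec hφ hn.1
    obtain ⟨o', ho', hψo⟩ := exists_imp_mem_of_decides hO hTO hdec hψ hn.2
    have hs := (hO.subset ho).1
    have hs' := (hO.subset ho').1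
    refine hTO _ (hO.or_mem o ho o' ho') (.mp (.or_elim ?_ ?_) (.hyp h (hT h).1))
    · exact .imp_trans (.hyp hφo (hT hφo).1) (.imp_intro hs (.or_left (.self hs) hs'))
    · exact .imp_trans (.hyp hψo (hT hψo).1) (.imp_intro hs' (.or_right hs (.self hs')))
  witness x φ h := by
    rcases hdec _ (hT h) with h' | ⟨o, ho, h'⟩
    · exact h'.2 x φ rfl
    · exact (hTO o ho (h'.mp (.hyp h (hT h).1))).elim

theorem exists_saturated (hSC : S ⊆ C) (hS : S.Infinite) (hA : A ⊆ sentences (C \ S))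
    (hO : OmitSet C S O) (hAO : Omits L A O) :
    ∃ T, Saturated L C T ∧ A ⊆ T ∧ MaxOmits L C T O := by
  have hext : Extendable L C S O A :=
    { subset := hA.trans (sentences_mono Set.sdiff_subset)
      infinite := hS.mono fun c hc =>
        ⟨hc, fun γ hγ => notMem_consts_of_mem_sentences (hA hγ) fun h => h.2 hc⟩
      omits := hAO }
  obtain ⟨T, hT, hAT, hTO, hdec⟩ := hext.exists_decides_all hSC hO
  exact ⟨T, hO.saturated_of_decides hT hTO hdec, hAT, hTO,
    fun _ => exists_imp_mem_of_decides hO hTO hdec⟩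

end Lindenbaum

namespace Saturated

variable {L : Logic σ} {C : Set σ.Const} {T : Set (Formula σ)} {φ ψ : Formula σ}

theorem der (hT : Saturated L C T) (h : φ ∈ T) : Der L T φ := .hyp h (hT.subset h).1

theorem top_mem (hT : Saturated L C T) : top ∈ T := hT.closed _ top_mem_sentences .top

theorem and_mem (hT : Saturated L C T) : .and φ ψ ∈ T ↔ φ ∈ T ∧ ψ ∈ T := by
  constructor
  · intro h
    obtain ⟨h₁, h₂⟩ := and_mem_sentences.1 (hT.subset h)
    exact ⟨hT.closed _ h₁ (hT.der h).and_left, hT.closed _ h₂ (hT.der h).and_right⟩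
  · rintro ⟨h₁, h₂⟩
    exact hT.closed _ (and_mem_sentences.2 ⟨hT.subset h₁, hT.subset h₂⟩)
      (.and_intro (hT.der h₁) (hT.der h₂))

theorem or_mem (hT : Saturated L C T) (h : .or φ ψ ∈ sentences C) :
    .or φ ψ ∈ T ↔ φ ∈ T ∨ ψ ∈ T := by
  refine ⟨hT.prime φ ψ, ?_⟩
  rintro (h' | h')
  · exact hT.closed _ h (.or_left (hT.der h') (or_mem_sentences.1 h).2.1)
  · exact hT.closed _ h (.or_right (or_mem_sentences.1 h).1.1 (hT.der h'))

theorem mp_mem (hT : Saturated L C T) (h : .imp φ ψ ∈ T) (h' : φ ∈ T) : ψ ∈ T :=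
  hT.closed _ (imp_mem_sentences.1 (hT.subset h)).2 ((hT.der h).mp (hT.der h'))

theorem exists_of_der_union (hT : Saturated L C T) {X : Set (Formula σ)}
    (h : Der L (X ∪ T) φ) : ∃ χ ∈ T, Der L X (.imp χ φ) :=
  Der.exists_imp_of_union (fun _ hχ => (hT.subset hχ).1) hT.top_mem
    (fun _ h _ h' => hT.and_mem.2 ⟨h, h'⟩) h

theorem unbox_subset (hT : Saturated L C T) : unbox T ⊆ sentences C :=
  fun φ (h : box φ ∈ T) => box_mem_sentences.1 (hT.subset h)

theorem exists_of_der_union_unbox (hT : Saturated L C T) {X : Set (Formula σ)}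
    (h : Der L (X ∪ unbox T) φ) : ∃ χ, box χ ∈ T ∧ Der L X (.imp χ φ) := by
  refine Der.exists_imp_of_union (fun χ hχ => (hT.unbox_subset hχ).1) ?_ (fun χ hχ χ' hχ' => ?_) h
  · exact hT.closed _ (box_mem_sentences.2 top_mem_sentences) (.nec .top)
  · exact hT.closed _ (box_mem_sentences.2 (and_mem_sentences.2
      ⟨hT.unbox_subset hχ, hT.unbox_subset hχ'⟩)) (.box_and (hT.der hχ) (hT.der hχ'))

end Saturated

/-! ### Modal successors -/

/-- `U` is a possible modal successor of the theory `T` in the language with constants `C`. -/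
def Step (C : Set σ.Const) (T U : Set (Formula σ)) : Prop :=
  unbox T ⊆ U ∧ ∀ φ ∈ U, φ ∈ sentences C → dia φ ∈ T

namespace Saturated

variable {L : Logic σ} {C C' S : Set σ.Const} {T : Set (Formula σ)}

/-- The sentences implying a sentence of the language of `T` that `T` takes to be impossible: a
theory `U ⊇ unbox T` is a successor of `T` as soon as it omits them. -/
theorem omitSet_impossible (hT : Saturated L C T) (hS : Disjoint S C) :
    OmitSet C' S {θ ∈ sentences C' | ∃ δ ∈ sentences C, dia δ ∉ T ∧ Der L ∅ (imp θ δ)} where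
  subset := Set.sep_subset _ _
  nonempty := by
    refine ⟨bot, bot_mem_sentences, bot, bot_mem_sentences, fun h => ?_, .imp_self rfl⟩
    exact hT.consistent (hT.closed _ bot_mem_sentences (.mp (.thm .diaBot) (hT.der h)))
  or_mem := by
    rintro o ⟨ho, δ, hδ, hδT, h⟩ o' ⟨ho', δ', hδ', hδT', h'⟩
    refine ⟨or_mem_sentences.2 ⟨ho, ho'⟩, .or δ δ', or_mem_sentences.2 ⟨hδ, hδ'⟩, fun hd => ?_,
      .or_elim (h.imp_trans ?_) (h'.imp_trans ?_)⟩
    · have hor : .or (dia δ) (dia δ') ∈ T := hT.closed _ (or_mem_sentences.2 ⟨hδ, hδ'⟩)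
        (.mp (.and_left (.thm (.diaOr hδ.1 hδ'.1))) (hT.der hd))
      exact (hT.prime _ _ hor).elim hδT hδT'
    · exact .imp_intro hδ.1 (.or_left (.self hδ.1) hδ'.1)
    · exact .imp_intro hδ'.1 (.or_right hδ.1 (.self hδ'.1))
  exClosed := by
    rintro c hc x φ hφ hcφ ⟨ho, δ, hδ, hδT, h⟩
    have hcδ := notMem_consts_of_mem_sentences hδ (hS.notMem_of_mem_left hc)
    exact ⟨ex_mem_sentences.2 ⟨hφ, (consts_subset_inst x c φ).trans ho.2⟩, δ, hδ, hδT,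
      .ex_elim hφ hcφ hcδ (by simp) h⟩

theorem exists_step (hT : Saturated L C T) (hC : C ⊆ C') (hSC' : S ⊆ C') (hS : S.Infinite)
    (hSC : Disjoint S C) {A : Set (Formula σ)} (hA : A ⊆ sentences (C' \ S))
    (hcons : ∀ δ ∈ sentences C, Der L (A ∪ unbox T) δ → dia δ ∈ T) :
    ∃ U, Saturated L C' U ∧ A ⊆ U ∧ Step C T U := by
  have hA' : A ∪ unbox T ⊆ sentences (C' \ S) :=
    Set.union_subset hA (hT.unbox_subset.trans (sentences_mono (Set.subset_sdiff.2 ⟨hC, hSC.symm⟩)))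
  obtain ⟨U, hU, hAU, hO⟩ := exists_saturated hSC' hS hA' (hT.omitSet_impossible hSC) (by
    rintro o ⟨-, δ, hδ, hδT, h⟩ ho
    exact hδT (hcons δ hδ ((h.mono (Set.empty_subset _)).mp ho)))
  refine ⟨U, hU, Set.subset_union_left.trans hAU, Set.subset_union_right.trans hAU,
    fun φ h hφ => ?_⟩
  by_contra hd
  exact hO.omits φ ⟨sentences_mono hC hφ, φ, hφ, hd, .imp_self hφ.1⟩ (hU.der h)

theorem exists_step_of_dia (hT : Saturated L C T) (hC : C ⊆ C') (hSC' : S ⊆ C') (hS : S.Infinite)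
    (hSC : Disjoint S C) {φ : Formula σ} (h : dia φ ∈ T) :
    ∃ U, Saturated L C' U ∧ φ ∈ U ∧ Step C T U := by
  have hφ : φ ∈ sentences C := dia_mem_sentences.1 (hT.subset h)
  obtain ⟨U, hU, hφU, hTU⟩ := hT.exists_step (A := {φ}) hC hSC' hS hSC
    (Set.singleton_subset_iff.2 (sentences_mono (Set.subset_sdiff.2 ⟨hC, hSC.symm⟩) hφ))
    fun δ hδ hd => by
      rw [Set.singleton_union] at hd
      exact hT.closed _ hδ (.dia_box_mp (hT.der h) (.box_of_unbox (.imp_intro hφ.1 hd)))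
  exact ⟨U, hU, hφU rfl, hTU⟩

end Saturated

namespace Saturated

variable {L : Logic σ} {C D D' : Set σ.Const} {T U X X' Y : Set (Formula σ)}

theorem exists_interpolant (hY : Saturated L C Y) {θ : Formula σ} (hθ : θ ∈ sentences D)
    (h : Der L Y θ) : ∃ η ∈ Y, η ∈ sentences (C ∩ D) ∧ Der L ∅ (imp η θ) := by
  obtain ⟨η, hη, hηθ⟩ := hY.exists_of_der_union (X := ∅) (by rwa [Set.empty_union])
  have hex : ExClosed Dᶜ {η ∈ Y | Der L ∅ (imp η θ)} := by
    rintro c hc x φ hφ hcφ ⟨h, h'⟩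
    have hφC : .ex x φ ∈ sentences C :=
      ex_mem_sentences.2 ⟨hφ, (consts_subset_inst x c φ).trans (hY.subset h).2⟩
    exact ⟨hY.closed _ hφC ((Der.ex_intro c hφ).mp (hY.der h)),
      .ex_elim hφ hcφ (notMem_consts_of_mem_sentences hθ hc) (by simp) h'⟩
  obtain ⟨η', ⟨hη', hη'θ⟩, hs⟩ := hex.exists_sentence (hY.subset hη).1 ⟨hη, hηθ⟩
  refine ⟨η', hη', ⟨hs.1, fun c hc => ⟨(hY.subset hη').2 hc, ?_⟩⟩, hη'θ⟩
  simpa using (hs.2 hc).2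

theorem dia_mem_of_der_union_unbox (hX' : Saturated L D' X') (hXX' : X ⊆ X')
    (hY : Saturated L C Y) (hXY : Step D X Y) (hCD : C ∩ D' ⊆ D) {δ : Formula σ}
    (hδ : δ ∈ sentences D') (hd : Der L (Y ∪ unbox X') δ) : dia δ ∈ X' := by
  obtain ⟨χ, hχX, hχ⟩ := hX'.exists_of_der_union_unbox hd
  have hχδ : .imp χ δ ∈ sentences D' := imp_mem_sentences.2 ⟨hX'.unbox_subset hχX, hδ⟩
  obtain ⟨η, hη, hηD, hηχ⟩ := hY.exists_interpolant hχδ hχ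
  have hdia : dia η ∈ X' := hXX' (hXY.2 η hη (sentences_mono hCD hηD))
  exact hX'.closed _ hδ (.dia_mp ((Der.dia_mono hηχ).mp (hX'.der hdia)) (hX'.der hχX))

theorem step_of_maximal (hT : Saturated L C T) (hU : Saturated L D U) (hTU : unbox T ⊆ U)
    (hmax : ∀ δ ∈ sentences C, dia δ ∉ T →
      ∃ χ ∈ sentences C, χ ∉ U ∧ Der L T (.imp (dia δ) (box χ))) : Step C T U := by
  refine ⟨hTU, fun δ hδU hδ => ?_⟩
  by_contra hd
  obtain ⟨χ, hχ, hχU, h⟩ := hmax δ hδ hd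
  have hbox : box (.imp δ χ) ∈ T :=
    hT.closed _ (imp_mem_sentences.2 ⟨hδ, hχ⟩) (.mp (.thm (.fs1 hδ.1 hχ.1)) h)
  exact hχU (hU.mp_mem (hTU hbox) hδU)

end Saturated

/-! ### Levels and stages -/

/-- A numbering assigns to each constant a level and a stage, the first two components, so that
infinitely many constants share any given level and stage. -/
abbrev Numbering (σ : Signature.{u}) := σ.Const ≃ ℕ × ℕ × σ.Const

/-- The constants of level at most `k` and stage at most `N`. -/
def lang (e : Numbering σ) (k N : ℕ) : Set σ.Const := {c | (e c).1 ≤ k ∧ (e c).2.1 ≤ N}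

/-- The constants of level `k` and stage `N`. -/
def layer (e : Numbering σ) (k N : ℕ) : Set σ.Const := {c | (e c).1 = k ∧ (e c).2.1 = N}

/-- The constants that are generic over theories of stage `N` and that may become witnesses in an
extension to stage `N'` of a chain of length `k + 1`: those of level below `k` may be used up by
the earlier members of the chain, those of `layer e k N'` by the last one. -/
def fresh (e : Numbering σ) (k N N' : ℕ) : Set σ.Const :=
  {c | N < (e c).2.1 ∧ (e c).2.1 ≤ N' ∧ ((e c).1 < k ∨ (e c).1 = k ∧ (e c).2.1 = N')}

section Numbering

variable {e : Numbering σ} {k k' k'' N N' N'' : ℕ}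

theorem lang_mono (hk : k ≤ k') (hN : N ≤ N') : lang e k N ⊆ lang e k' N' :=
  fun _ h => ⟨h.1.trans hk, h.2.trans hN⟩

theorem layer_subset_lang : layer e k N ⊆ lang e k N := fun _ h => ⟨h.1.le, h.2.le⟩

theorem layer_infinite : (layer e k N).Infinite :=
  Set.infinite_of_injective_forall_mem (f := fun c => e.symm (k, N, c))
    (fun c d h => by simpa using h) fun c => by simp [layer]

theorem layer_subset_fresh (h : N < N') : layer e k N' ⊆ fresh e k N N' :=
  fun _ hc => ⟨hc.2 ▸ h, hc.2.le, .inr hc⟩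

theorem fresh_subset_fresh_succ : fresh e k N N' ⊆ fresh e (k + 1) N N' :=
  fun _ hc => ⟨hc.1, hc.2.1, .inl (by have := hc.2.2; omega)⟩

theorem disjoint_fresh_lang : Disjoint (fresh e k N N') (lang e k' N) :=
  Set.disjoint_left.2 fun _ h h' => h'.2.not_gt h.1

theorem disjoint_layer_fresh (h : N' < N'') : Disjoint (layer e k N') (fresh e k N N'') :=
  Set.disjoint_left.2 fun _ h h' => by have := h.1; have := h.2; have := h'.2.2; omega

theorem disjoint_layer_lang_of_level (h : k' < k) : Disjoint (layer e k N) (lang e k' N') :=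
  Set.disjoint_left.2 fun _ h h' => by have := h.1; have := h'.1; omega

theorem disjoint_layer_lang_of_stage (h : N' < N) : Disjoint (layer e k N) (lang e k' N') :=
  Set.disjoint_left.2 fun _ h h' => by have := h.2; have := h'.2; omega

theorem lang_sdiff_fresh_succ_subset : lang e k N' \ fresh e (k + 1) N N' ⊆ lang e k N :=
  fun _ hc => ⟨hc.1.1, not_lt.1 fun h => hc.2 ⟨h, hc.1.2, .inl (Nat.lt_succ_of_le hc.1.1)⟩⟩

theorem lang_inter_lang_subset : lang e k' N ∩ lang e k N' ⊆ lang e k N :=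
  fun _ hc => ⟨hc.2.1, hc.1.2⟩

theorem lang_subset_sdiff_fresh (h : N ≤ N') : lang e k N ⊆ lang e k N' \ fresh e k'' N N' :=
  Set.subset_sdiff.2 ⟨lang_mono le_rfl h, disjoint_fresh_lang.symm⟩

theorem lang_subset_sdiff_layer (h : N < N') : lang e k N ⊆ lang e k N' \ layer e k N' :=
  Set.subset_sdiff.2 ⟨lang_mono le_rfl h.le, (disjoint_layer_lang_of_stage h).symm⟩

theorem lang_subset_sdiff_layer_succ : lang e k N ⊆ lang e (k + 1) N \ layer e (k + 1) N :=
  Set.subset_sdiff.2 ⟨lang_mono k.le_succ le_rfl,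
    (disjoint_layer_lang_of_level k.lt_succ_self).symm⟩

end Numbering

/-! ### Ideals of sentences to omit -/

/-- Sets of sentences closed downwards under implications derivable from `G`, which can be
omitted by extensions of `G`. -/
structure OmitIdeal (L : Logic σ) (C S : Set σ.Const) (G O : Set (Formula σ)) : Prop
    extends OmitSet C S O where
  down : ∀ θ ∈ sentences C, ∀ o ∈ O, Der L G (imp θ o) → θ ∈ O
  proper : Omits L G O

/-- The principal ideal of the sentences that imply `ψ` over `G`. -/
def below (L : Logic σ) (C : Set σ.Const) (G : Set (Formula σ)) (ψ : Formula σ) :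
    Set (Formula σ) := {θ ∈ sentences C | Der L G (imp θ ψ)}

/-- The sentences that have to be omitted by an extension of `G` in order that one of its modal
successors can omit `O`. -/
def boxBelow (L : Logic σ) (C : Set σ.Const) (G O : Set (Formula σ)) : Set (Formula σ) :=
  {θ ∈ sentences C | ∃ χ ∈ O, χ ∈ sentences C ∧ Der L G (imp θ (box χ))}

namespace OmitIdeal

variable {L : Logic σ} {C C' D S S' : Set σ.Const} {G G' T U O : Set (Formula σ)} {ψ : Formula σ}

theorem anti (h : OmitIdeal L C S G O) (hG : G' ⊆ G) : OmitIdeal L C S G' O where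
  toOmitSet := h.toOmitSet
  down θ hθ o ho h' := h.down θ hθ o ho (h'.mono hG)
  proper o ho h' := h.proper o ho (h'.mono hG)

theorem below (hG : G ⊆ sentences Sᶜ) (hψ : ψ ∈ sentences (C \ S)) (h : ¬ Der L G ψ) :
    OmitIdeal L C S G (below L C G ψ) where
  subset := Set.sep_subset _ _
  nonempty := ⟨ψ, sentences_mono Set.sdiff_subset hψ, .imp_self hψ.1⟩
  or_mem _ ho _ ho' := ⟨or_mem_sentences.2 ⟨ho.1, ho'.1⟩, .or_elim ho.2 ho'.2⟩
  exClosed := fun c hc x φ hφ hcφ h =>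
    ⟨ex_mem_sentences.2 ⟨hφ, (consts_subset_inst x c φ).trans h.1.2⟩,
      .ex_elim hφ hcφ (notMem_consts_of_mem_sentences hψ fun h => h.2 hc)
        (fun _ hγ => notMem_consts_of_mem_sentences (hG hγ) (not_not.2 hc)) h.2⟩
  down _ hθ _ ho h := ⟨hθ, h.imp_trans ho.2⟩
  proper _ ho h' := h (ho.2.mp h')

theorem omits_boxBelow (hT : Saturated L D T) (hTU : Step D T U) (hCD : C \ S ⊆ D)
    (hO : OmitIdeal L C' S U O) : Omits L T (boxBelow L C T O) := by
  rintro θ ⟨-, χ, hχO, hχ, hθχ⟩ hθ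
  have hex : ExClosed S {χ ∈ O | Der L T (box χ)} := fun c hc x φ hφ hcφ h =>
    ⟨hO.exClosed c hc x φ hφ hcφ h.1, (Der.box_mono (.ex_intro c hφ)).mp h.2⟩
  obtain ⟨χ', ⟨hχ'O, hχ'⟩, hs⟩ := hex.exists_sentence hχ.1 ⟨hχO, hθχ.mp hθ⟩
  have hχ'D : χ' ∈ sentences D :=
    sentences_mono ((Set.sdiff_subset_sdiff_left hχ.2).trans hCD) hs
  have hχ'U : χ' ∈ U := hTU.1 (hT.closed _ (box_mem_sentences.2 hχ'D) hχ')
  exact hO.proper χ' hχ'O (.hyp hχ'U hs.1)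

theorem boxBelow (hT : Saturated L D T) (hTU : Step D T U) (hSD : Disjoint S D) (hS : S ⊆ S')
    (hCD : C \ S' ⊆ D) (hO : OmitIdeal L C' S' U O) : OmitIdeal L C S T (boxBelow L C T O) where
  subset := Set.sep_subset _ _
  nonempty := by
    obtain ⟨o, ho⟩ := hO.nonempty
    have hbot {φ : Formula σ} (hφ : φ.IsSentence) {G : Set (Formula σ)} : Der L G (imp bot φ) :=
      .imp_intro rfl (.bot_elim (.self rfl) hφ)
    exact ⟨bot, bot_mem_sentences, bot, hO.down bot bot_mem_sentences o ho (hbot (hO.subset ho).1),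
      bot_mem_sentences, hbot (isSentence_box.2 isSentence_bot)⟩
  or_mem := by
    rintro o ⟨ho, χ, hχO, hχ, h⟩ o' ⟨ho', χ', hχO', hχ', h'⟩
    refine ⟨or_mem_sentences.2 ⟨ho, ho'⟩, or χ χ', hO.or_mem χ hχO χ' hχO',
      or_mem_sentences.2 ⟨hχ, hχ'⟩, .or_elim (h.imp_trans ?_) (h'.imp_trans ?_)⟩
    · exact .box_mono (.imp_intro hχ.1 (.or_left (.self hχ.1) hχ'.1))
    · exact .box_mono (.imp_intro hχ'.1 (.or_right hχ.1 (.self hχ'.1)))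
  exClosed := by
    rintro c hc x φ hφ hcφ ⟨ho, χ, hχO, hχ, h⟩
    obtain ⟨y, θ, hθ, rfl, hθc⟩ := hχ.1.exists_eq_inst c
    have hcθ : c ∉ θ.consts := fun hc => (hθc hc).2 rfl
    refine ⟨ex_mem_sentences.2 ⟨hφ, (consts_subset_inst x c φ).trans ho.2⟩, ex y θ,
      hO.exClosed c (hS hc) y θ hθ hcθ hχO,
      ex_mem_sentences.2 ⟨hθ, (consts_subset_inst y c θ).trans hχ.2⟩,
      .ex_elim hφ hcφ hcθ (fun γ hγ => ?_) (h.imp_trans (.box_mono (.ex_intro c hθ)))⟩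
    exact notMem_consts_of_mem_sentences (hT.subset hγ) (hSD.notMem_of_mem_left hc)
  down := by
    rintro θ hθ o ⟨-, χ, hχO, hχ, h⟩ h'
    exact ⟨hθ, χ, hχO, hχ, h'.imp_trans h⟩
  proper := omits_boxBelow hT hTU hCD hO

end OmitIdeal

/-! ### Chains of theories -/

/-- Sequences `T 0, …, T k` of saturated theories at stage `N`, each one a modal successor of the
preceding one. -/
structure Chain (L : Logic σ) (e : Numbering σ) (k N : ℕ) (T : ℕ → Set (Formula σ)) : Prop where
  sat : ∀ i ≤ k, Saturated L (lang e i N) (T i)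
  step : ∀ i < k, Step (lang e i N) (T i) (T (i + 1))

namespace Chain

variable {L : Logic σ} {e : Numbering σ} {k N N' : ℕ} {T : ℕ → Set (Formula σ)}

theorem last (hT : Chain L e k N T) : Saturated L (lang e k N) (T k) := hT.sat k le_rfl

theorem init (hT : Chain L e (k + 1) N T) : Chain L e k N T :=
  ⟨fun i hi => hT.sat i (by omega), fun i hi => hT.step i (by omega)⟩

theorem snoc (hT : Chain L e k N T) {U : Set (Formula σ)} (hU : Saturated L (lang e (k + 1) N) U)
    (hTU : Step (lang e k N) (T k) U) : Chain L e (k + 1) N (Function.update T (k + 1) U) := by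
  refine ⟨fun i hi => ?_, fun i hi => ?_⟩
  · rcases hi.lt_or_eq with hi | rfl
    · rw [Function.update_of_ne hi.ne]
      exact hT.sat i (by omega)
    · rwa [Function.update_self]
  · rw [Function.update_of_ne hi.ne]
    rcases Nat.lt_or_eq_of_le (Nat.le_of_lt_succ hi) with hi | rfl
    · rw [Function.update_of_ne (by omega)]
      exact hT.step i hi
    · rwa [Function.update_self]

theorem exists_snoc (hT : Chain L e k N T) {A O : Set (Formula σ)}
    (hA : A ⊆ sentences (lang e (k + 1) N \ layer e (k + 1) N))
    (hO : OmitSet (lang e (k + 1) N) (layer e (k + 1) N) O) (hAO : Omits L (A ∪ unbox (T k)) O)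
    (hmax : ∀ δ ∈ sentences (lang e k N), dia δ ∉ T k →
      ∃ χ ∈ O, χ ∈ sentences (lang e k N) ∧ Der L (T k) (.imp (dia δ) (box χ))) :
    ∃ U, Chain L e (k + 1) N (Function.update T (k + 1) U) ∧ A ⊆ U ∧
      MaxOmits L (lang e (k + 1) N) U O := by
  obtain ⟨U, hU, hAU, hUO⟩ := exists_saturated layer_subset_lang layer_infinite (Set.union_subset hA
    (hT.last.unbox_subset.trans (sentences_mono lang_subset_sdiff_layer_succ))) hO hAO
  refine ⟨U, hT.snoc hU ?_, Set.subset_union_left.trans hAU, hUO⟩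
  refine hT.last.step_of_maximal hU (Set.subset_union_right.trans hAU) fun δ hδ hd => ?_
  obtain ⟨χ, hχO, hχ, h⟩ := hmax δ hδ hd
  exact ⟨χ, hχ, fun hχU => hUO.omits χ hχO (hU.der hχU), h⟩

theorem exists_extension_zero (hT : Chain L e 0 N T) (hN : N < N') {O : Set (Formula σ)}
    (hO : OmitIdeal L (lang e 0 N') (fresh e 0 N N') (T 0) O) :
    ∃ T', Chain L e 0 N' T' ∧ (∀ i ≤ 0, T i ⊆ T' i) ∧ MaxOmits L (lang e 0 N') (T' 0) O := by
  obtain ⟨U, hU, hTU, hUO⟩ := exists_saturated layer_subset_lang layer_infinite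
    (hT.last.subset.trans (sentences_mono (lang_subset_sdiff_layer hN)))
    { hO with exClosed := hO.exClosed.anti (layer_subset_fresh hN) } hO.proper
  refine ⟨fun _ => U, ⟨fun i hi => ?_, fun i hi => absurd hi i.not_lt_zero⟩, fun i hi => ?_, hUO⟩
  · rwa [Nat.le_zero.1 hi]
  · rwa [Nat.le_zero.1 hi]

theorem exists_extension (hT : Chain L e k N T) (hN : N < N') {O : Set (Formula σ)}
    (hO : OmitIdeal L (lang e k N') (fresh e k N N') (T k) O) :
    ∃ T', Chain L e k N' T' ∧ (∀ i ≤ k, T i ⊆ T' i) ∧ MaxOmits L (lang e k N') (T' k) O := by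
  induction k generalizing O with
  | zero => exact hT.exists_extension_zero hN hO
  | succ k ih =>
    obtain ⟨T', hT', hTT', hmax⟩ := ih hT.init (hO.boxBelow hT.init.last (hT.step k k.lt_succ_self)
      disjoint_fresh_lang fresh_subset_fresh_succ lang_sdiff_fresh_succ_subset)
    have homits : Omits L (T (k + 1) ∪ unbox (T' k)) O := fun o ho h => by
      obtain ⟨χ, hχT, hχ⟩ := hT'.last.exists_of_der_union_unbox h
      have hχL : χ ∈ sentences (lang e k N') := hT'.last.unbox_subset hχT
      have hχO : χ ∈ O := hO.down χ (sentences_mono (lang_mono k.le_succ le_rfl) hχL) o ho hχ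
      exact hmax.omits (box χ) ⟨hχL, χ, hχO, hχL, .imp_self hχL.1⟩ (hT'.last.der hχT)
    have hdia : ∀ δ ∈ sentences (lang e k N'), dia δ ∉ T' k →
        ∃ χ ∈ O, χ ∈ sentences (lang e k N') ∧ Der L (T' k) (.imp (dia δ) (box χ)) :=
      fun δ hδ hd => by
        obtain ⟨o, ⟨-, χ, hχO, hχ, h⟩, ho⟩ := hmax.exists_imp_mem (dia δ) hδ hd
        exact ⟨χ, hχO, hχ, (hT'.last.der ho).imp_trans (h.mono (hTT' k le_rfl))⟩
    obtain ⟨U, hU, hTU, hUO⟩ := hT'.exists_snoc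
      (hT.last.subset.trans (sentences_mono (lang_subset_sdiff_layer hN)))
      { hO with exClosed := hO.exClosed.anti (layer_subset_fresh hN) } homits hdia
    refine ⟨_, hU, fun i hi => ?_, by rwa [Function.update_self]⟩
    rcases hi.lt_or_eq with hi | rfl
    · rw [Function.update_of_ne hi.ne]
      exact hTT' i (by omega)
    · rwa [Function.update_self]

theorem exists_extension_omitting (hT : Chain L e k N T) (hN : N < N') {G : Set (Formula σ)}
    (hTG : T k ⊆ G) (hG : G ⊆ sentences (lang e k N)) {ψ : Formula σ}
    (hψ : ψ ∈ sentences (lang e k N' \ fresh e k N N')) (h : ¬ Der L G ψ) :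
    ∃ T', Chain L e k N' T' ∧ (∀ i ≤ k, T i ⊆ T' i) ∧ ψ ∉ T' k ∧
      MaxOmits L (lang e k N') (T' k) (below L (lang e k N') G ψ) := by
  have hG' : G ⊆ sentences (fresh e k N N')ᶜ :=
    hG.trans (sentences_mono disjoint_fresh_lang.symm.subset_compl_right)
  obtain ⟨T', hT', hTT', hmax⟩ := hT.exists_extension hN ((OmitIdeal.below hG' hψ h).anti hTG)
  exact ⟨T', hT', hTT', fun hψT => hmax.omits ψ
    ⟨sentences_mono Set.sdiff_subset hψ, .imp_self hψ.1⟩ (hT'.last.der hψT), hmax⟩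

theorem exists_of_imp_notMem (hT : Chain L e k N T) {φ ψ : Formula σ}
    (hφψ : .imp φ ψ ∈ sentences (lang e k N)) (h : .imp φ ψ ∉ T k) :
    ∃ T', Chain L e k (N + 1) T' ∧ (∀ i ≤ k, T i ⊆ T' i) ∧ φ ∈ T' k ∧ ψ ∉ T' k := by
  obtain ⟨hφ, hψ⟩ := imp_mem_sentences.1 hφψ
  have hsub : (sentences (lang e k N) : Set (Formula σ)) ⊆ sentences (lang e k (N + 1)) :=
    sentences_mono (lang_mono le_rfl N.le_succ)
  obtain ⟨T', hT', hTT', hψT, hmax⟩ := hT.exists_extension_omitting N.lt_succ_self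
    (Set.subset_insert φ (T k)) (Set.insert_subset hφ hT.last.subset)
    (sentences_mono (lang_subset_sdiff_fresh N.le_succ) hψ)
    fun h' => h (hT.last.closed _ hφψ (.imp_intro hφ.1 h'))
  refine ⟨T', hT', hTT', ?_, hψT⟩
  by_contra hφT
  -- `T' k` contains `φ → o` for some `o` implying `ψ` over `φ`, hence it contains `φ → ψ`.
  obtain ⟨o, ho, hφo⟩ := hmax.exists_imp_mem φ (hsub hφ) hφT
  have hoψ : Der L (insert φ (T' k)) (.imp o ψ) :=
    ho.2.mono (Set.insert_subset_insert (hTT' k le_rfl))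
  have hφψT : .imp φ ψ ∈ T' k := hT'.last.closed _ (hsub hφψ)
    (.imp_intro hφ.1 (hoψ.mp (hT'.last.der hφo).imp_elim))
  exact hmax.omits (.imp φ ψ)
    ⟨hsub hφψ, .imp_intro hφψ.1 ((Der.self hφψ.1).mp (Der.self hφ.1).weaken)⟩ (hT'.last.der hφψT)

theorem exists_of_box_notMem (hT : Chain L e k N T) {φ : Formula σ}
    (hφ : φ ∈ sentences (lang e k N)) (h : box φ ∉ T k) :
    ∃ T', Chain L e (k + 1) (N + 1) T' ∧ (∀ i ≤ k, T i ⊆ T' i) ∧ φ ∉ T' (k + 1) := by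
  have hφN : φ ∈ sentences (lang e k (N + 1)) := sentences_mono (lang_mono le_rfl N.le_succ) hφ
  have hφS : φ ∈ sentences (lang e (k + 1) (N + 1) \ layer e (k + 1) (N + 1)) :=
    sentences_mono lang_subset_sdiff_layer_succ hφN
  have hφL : φ ∈ sentences (lang e (k + 1) (N + 1)) := sentences_mono Set.sdiff_subset hφS
  obtain ⟨T', hT', hTT', hbox, hmax⟩ := hT.exists_extension_omitting N.lt_succ_self subset_rfl
    hT.last.subset (sentences_mono (lang_subset_sdiff_fresh N.le_succ) (box_mem_sentences.2 hφ))
    fun h' => h (hT.last.closed _ hφ h')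
  have hnφ : ¬ Der L (unbox (T' k)) φ := fun h' => hbox (hT'.last.closed _ hφN (.box_of_unbox h'))
  have hO := OmitIdeal.below (L := L) (Set.empty_subset _) hφS
    fun h' => hnφ (h'.mono (Set.empty_subset _))
  obtain ⟨U, hU, -, hUO⟩ := hT'.exists_snoc (Set.empty_subset _) hO.toOmitSet
    (fun o ho h' => hnφ ((ho.2.mono (Set.empty_subset _)).mp (by rwa [Set.empty_union] at h')))
    fun δ hδ hd => by
      obtain ⟨o, ho, hδo⟩ := hmax.exists_imp_mem (dia δ) hδ hd
      exact ⟨φ, ⟨hφL, .imp_self hφ.1⟩, hφN,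
        (hT'.last.der hδo).imp_trans (ho.2.mono (hTT' k le_rfl))⟩
  refine ⟨_, hU, fun i hi => ?_, fun hφU => ?_⟩
  · rw [Function.update_of_ne (by omega)]
    exact hTT' i hi
  · exact hUO.omits φ ⟨hφL, .imp_self hφ.1⟩ (by simpa using hU.last.der hφU)

theorem exists_of_all_notMem (hT : Chain L e k N T) {x : ℕ} {φ : Formula σ}
    (hφ : all x φ ∈ sentences (lang e k N)) (h : all x φ ∉ T k) :
    ∃ T', Chain L e k (N + 2) T' ∧ (∀ i ≤ k, T i ⊆ T' i) ∧
      ∃ c ∈ lang e k (N + 2), φ.inst x c ∉ T' k := by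
  obtain ⟨hφx, hφL⟩ := all_mem_sentences.1 hφ
  -- A constant of the intermediate stage `N + 1` is new to `T k` and is not `fresh e k N (N + 2)`.
  obtain ⟨c, hc⟩ := (layer_infinite (e := e) (k := k) (N := N + 1)).nonempty
  have hcN : c ∉ lang e k N := (disjoint_layer_lang_of_stage N.lt_succ_self).notMem_of_mem_left hc
  have hcL : c ∈ lang e k (N + 2) := lang_mono le_rfl (N + 1).le_succ (layer_subset_lang hc)
  have hinst : φ.inst x c ∈ sentences (lang e k (N + 2) \ fresh e k N (N + 2)) :=
    inst_mem_sentences hφx (hφL.trans (lang_subset_sdiff_fresh (by omega)))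
      ⟨hcL, (disjoint_layer_fresh (N + 1).lt_succ_self).notMem_of_mem_left hc⟩
  obtain ⟨T', hT', hTT', hφT, -⟩ := hT.exists_extension_omitting (by omega) subset_rfl
    hT.last.subset hinst fun h' => h (hT.last.closed _ hφ (.gen hφx (fun h => hcN (hφL h))
      (fun γ hγ => notMem_consts_of_mem_sentences (hT.last.subset hγ) hcN) h'))
  exact ⟨T', hT', hTT', c, hcL, hφT⟩

theorem exists_of_dia_mem (hT : Chain L e k N T) {φ : Formula σ} (h : dia φ ∈ T k) :
    ∃ U, Saturated L (lang e (k + 1) N) U ∧ φ ∈ U ∧ Step (lang e k N) (T k) U :=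
  hT.last.exists_step_of_dia (lang_mono k.le_succ le_rfl) (layer_subset_lang (k := k + 1))
    layer_infinite (disjoint_layer_lang_of_level k.lt_succ_self) h

end Chain

theorem Saturated.exists_step_extension {L : Logic σ} {e : Numbering σ} {k N N' : ℕ} (hN : N < N')
    {X X' Y : Set (Formula σ)} (hX' : Saturated L (lang e k N') X') (hXX' : X ⊆ X')
    (hY : Saturated L (lang e (k + 1) N) Y) (hXY : Step (lang e k N) X Y) :
    ∃ Y', Saturated L (lang e (k + 1) N') Y' ∧ Y ⊆ Y' ∧ Step (lang e k N') X' Y' :=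
  hX'.exists_step (lang_mono k.le_succ le_rfl) (layer_subset_lang (k := k + 1)) layer_infinite
    (disjoint_layer_lang_of_level k.lt_succ_self)
    (hY.subset.trans (sentences_mono (lang_subset_sdiff_layer hN)))
    fun _ => hX'.dia_mem_of_der_union_unbox hXX' hY hXY lang_inter_lang_subset

/-! ### Equality in saturated theories -/

theorem eq_mem_sentences {C : Set σ.Const} {a b : σ.Const} :
    eq (.const a) (.const b) ∈ sentences C ↔ a ∈ C ∧ b ∈ C := by
  simp [sentences, IsSentence, freeVars, Term.vars, consts, Term.consts, Set.insert_subset_iff,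
    and_comm]

namespace Saturated

variable {L : Logic σ} {C : Set σ.Const} {T : Set (Formula σ)} {a b c : σ.Const}

theorem eq_refl (hT : Saturated L C T) (ha : a ∈ C) : eq (.const a) (.const a) ∈ T :=
  hT.closed _ (eq_mem_sentences.2 ⟨ha, ha⟩) (.thm (.idRef a))

theorem inst_mem_of_eq_mem (hT : Saturated L C T) (h : eq (.const a) (.const b) ∈ T) {x : ℕ}
    {φ : Formula σ} (hφ : OnePlace x φ) (hm : φ.ModalFree) (h' : φ.inst x a ∈ T) :
    φ.inst x b ∈ T :=
  hT.closed _ (inst_mem_sentences hφ ((consts_subset_inst x a φ).trans (hT.subset h').2)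
    (eq_mem_sentences.1 (hT.subset h)).2)
    (.mp (.mp (.thm (.idSub a b hφ hm)) (hT.der h)) (hT.der h'))

theorem eq_symm (hT : Saturated L C T) (h : eq (.const a) (.const b) ∈ T) :
    eq (.const b) (.const a) ∈ T := by
  have hsubst := hT.inst_mem_of_eq_mem h (x := 0) (φ := eq (.var 0) (.const a))
    (by simp [OnePlace, freeVars, Term.vars]) trivial
  simp only [inst, Term.inst, if_true] at hsubst
  exact hsubst (hT.eq_refl (eq_mem_sentences.1 (hT.subset h)).1)

theorem eq_trans (hT : Saturated L C T) (h : eq (.const a) (.const b) ∈ T)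
    (h' : eq (.const b) (.const c) ∈ T) : eq (.const a) (.const c) ∈ T := by
  have hsubst := hT.inst_mem_of_eq_mem h' (x := 0) (φ := eq (.const a) (.var 0))
    (by simp [OnePlace, freeVars, Term.vars]) trivial
  simp only [inst, Term.inst, if_true] at hsubst
  exact hsubst h

theorem rel_mem_of_eq_mem (hT : Saturated L C T) {P : σ.Pred} {a b : Fin (σ.arity P) → σ.Const}
    (h : ∀ i, eq (.const (a i)) (.const (b i)) ∈ T) (ha : rel P (fun i => .const (a i)) ∈ T) :
    rel P (fun i => .const (b i)) ∈ T := by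
  -- Replace the arguments one at a time.
  have key (s : Finset (Fin (σ.arity P))) :
      rel P (fun i => .const (if i ∈ s then b i else a i)) ∈ T := by
    induction s using Finset.induction_on with
    | empty => simpa using ha
    | insert i s his ih =>
      have hsubst := hT.inst_mem_of_eq_mem (h i) (x := 0)
        (φ := rel P fun j => if j = i then .var 0 else .const (if j ∈ s then b j else a j)) (by
          refine Set.iUnion_subset fun j => ?_
          by_cases hj : j = i <;> simp [hj, Term.vars]) trivial
      simp only [inst] at hsubst
      convert hsubst ?_ using 3 with j
      · by_cases hj : j = i <;> simp [hj, Term.inst]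
      · convert ih using 3 with j
        by_cases hj : j = i <;> simp [hj, his, Term.inst]
  simpa using key Finset.univ

end Saturated

/-! ### The canonical model -/

/-- The worlds of the canonical model: chains of theories at some stage. -/
structure ChainWorld (L : Logic σ) (e : Numbering σ) where
  depth : ℕ
  stage : ℕ
  theories : ℕ → Set (Formula σ)
  chain : Chain L e depth stage theories

namespace ChainWorld

variable {L : Logic σ} {e : Numbering σ} {w w' w'' v v' : ChainWorld L e}

/-- The constants of the language of a world, which form its domain. -/
def dom (w : ChainWorld L e) : Set σ.Const := lang e w.depth w.stage

/-- The sentences true at a world: the last theory of the chain. -/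
def theory (w : ChainWorld L e) : Set (Formula σ) := w.theories w.depth

/-- The intuitionistic order.  A proper extension has a larger stage, whence antisymmetry. -/
def le (w w' : ChainWorld L e) : Prop :=
  w = w' ∨ w.stage < w'.stage ∧ w.depth = w'.depth ∧ ∀ i ≤ w.depth, w.theories i ⊆ w'.theories i

/-- The modal relation: the chain of `v` is that of `w` with one more theory. -/
def acc (w v : ChainWorld L e) : Prop :=
  v.depth = w.depth + 1 ∧ v.stage = w.stage ∧ ∀ i ≤ w.depth, v.theories i = w.theories i

theorem sat (w : ChainWorld L e) : Saturated L w.dom w.theory := w.chain.last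

theorem le_trans (h : w.le w') (h' : w'.le w'') : w.le w'' := by
  rcases h with rfl | ⟨hs, hd, ht⟩
  · exact h'
  · rcases h' with rfl | ⟨hs', hd', ht'⟩
    · exact .inr ⟨hs, hd, ht⟩
    · exact .inr ⟨hs.trans hs', hd.trans hd', fun i hi => (ht i hi).trans (ht' i (hd ▸ hi))⟩

theorem le_antisymm (h : w.le w') (h' : w'.le w) : w = w' := by
  rcases h with rfl | ⟨hs, -⟩
  · rfl
  · rcases h' with rfl | ⟨hs', -⟩
    · rfl
    · exact absurd hs hs'.not_gt

theorem dom_mono (h : w.le w') : w.dom ⊆ w'.dom := by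
  rcases h with rfl | ⟨hs, hd, -⟩
  · exact subset_rfl
  · exact lang_mono hd.le hs.le

theorem dom_acc (h : w.acc v) : w.dom ⊆ v.dom := lang_mono (by have := h.1; omega) h.2.1.ge

theorem theory_mono (h : w.le w') : w.theory ⊆ w'.theory := by
  rcases h with rfl | ⟨-, hd, ht⟩
  · exact subset_rfl
  · rw [theory, theory, ← hd]
    exact ht _ le_rfl

theorem acc_step (h : w.acc v) : Step w.dom w.theory v.theory := by
  obtain ⟨hd, hs, ht⟩ := h
  have hstep := v.chain.step w.depth (by omega)
  rwa [hs, ht _ le_rfl, ← hd] at hstep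

/-- The modal successor of `w` whose chain ends with `U`. -/
def snoc (w : ChainWorld L e) (U : Set (Formula σ))
    (hU : Saturated L (lang e (w.depth + 1) w.stage) U) (h : Step w.dom w.theory U) :
    ChainWorld L e :=
  ⟨w.depth + 1, w.stage, Function.update w.theories (w.depth + 1) U, w.chain.snoc hU h⟩

section Snoc

variable {U : Set (Formula σ)} {hU : Saturated L (lang e (w.depth + 1) w.stage) U}
  {h : Step w.dom w.theory U}

theorem acc_snoc : w.acc (w.snoc U hU h) :=
  ⟨rfl, rfl, fun _ hi => Function.update_of_ne (by omega) _ _⟩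

theorem theory_snoc : (w.snoc U hU h).theory = U := Function.update_self ..

end Snoc

theorem exists_le_acc (h : w.acc v) (h' : v.le v') : ∃ w', w.le w' ∧ w'.acc v' := by
  rcases h' with rfl | ⟨hs', hd', ht'⟩
  · exact ⟨w, .inl rfl, h⟩
  · obtain ⟨hd, hs, ht⟩ := h
    have hv' : v'.depth = w.depth + 1 := hd'.symm.trans hd
    have hchain : Chain L e (w.depth + 1) v'.stage v'.theories := hv' ▸ v'.chain
    refine ⟨⟨w.depth, v'.stage, v'.theories, hchain.init⟩, .inr ⟨hs ▸ hs', rfl, fun i hi => ?_⟩,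
      hv', rfl, fun _ _ => rfl⟩
    rw [← ht i hi]
    exact ht' i (by omega)

theorem exists_acc_le (h : w.le w') (h' : w.acc v) : ∃ v', v.le v' ∧ w'.acc v' := by
  rcases h with rfl | hlt
  · exact ⟨v, .inl rfl, h'⟩
  · have hXX' : w.theory ⊆ w'.theory := theory_mono (.inr hlt)
    obtain ⟨hs, hd, ht⟩ := hlt
    have hstep := acc_step h'
    obtain ⟨hd', hs', ht'⟩ := h'
    have hv : v.depth = w'.depth + 1 := hd'.trans (congrArg (· + 1) hd)
    have hY : Saturated L (lang e (w'.depth + 1) w.stage) v.theory := hv ▸ hs' ▸ v.sat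
    rw [dom, hd] at hstep
    obtain ⟨Y', hY', hYY', hstep'⟩ := w'.sat.exists_step_extension hs hXX' hY hstep
    refine ⟨w'.snoc Y' hY' hstep', .inr ⟨by rwa [hs'], hv, fun i hi => ?_⟩, acc_snoc⟩
    simp only [snoc]
    rcases hi.lt_or_eq with hi | rfl
    · rw [Function.update_of_ne (by omega), ht' i (by omega)]
      exact ht i (by omega)
    · rw [hv, Function.update_self, ← hv]
      exact hYY'

section Theory

variable {φ ψ : Formula σ} {x : ℕ}

theorem imp_mem_theory (hL : .imp φ ψ ∈ sentences w.dom) :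
    .imp φ ψ ∈ w.theory ↔ ∀ w', w.le w' → φ ∈ w'.theory → ψ ∈ w'.theory := by
  refine ⟨fun h w' hw => w'.sat.mp_mem (theory_mono hw h), fun h => ?_⟩
  by_contra hn
  obtain ⟨T', hT', hTT', hφ, hψ⟩ := w.chain.exists_of_imp_notMem hL hn
  exact hψ (h ⟨w.depth, w.stage + 1, T', hT'⟩ (.inr ⟨w.stage.lt_succ_self, rfl, hTT'⟩) hφ)

theorem box_mem_theory (hL : φ ∈ sentences w.dom) :
    box φ ∈ w.theory ↔ ∀ w' v', w.le w' → w'.acc v' → φ ∈ v'.theory := by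
  refine ⟨fun h w' v' hw hv => (acc_step hv).1 (theory_mono hw h), fun h => ?_⟩
  by_contra hn
  obtain ⟨T', hT', hTT', hφ⟩ := w.chain.exists_of_box_notMem hL hn
  exact hφ (h ⟨w.depth, w.stage + 1, T', hT'.init⟩ ⟨w.depth + 1, w.stage + 1, T', hT'⟩
    (.inr ⟨w.stage.lt_succ_self, rfl, hTT'⟩) ⟨rfl, rfl, fun _ _ => rfl⟩)

theorem dia_mem_theory (hL : φ ∈ sentences w.dom) :
    dia φ ∈ w.theory ↔ ∃ v, w.acc v ∧ φ ∈ v.theory := by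
  refine ⟨fun h => ?_, fun ⟨v, hv, hφ⟩ => (acc_step hv).2 φ hφ hL⟩
  obtain ⟨U, hU, hφ, hstep⟩ := w.chain.exists_of_dia_mem h
  exact ⟨w.snoc U hU hstep, acc_snoc, theory_snoc.symm ▸ hφ⟩

theorem all_mem_theory (hL : all x φ ∈ sentences w.dom) :
    all x φ ∈ w.theory ↔ ∀ w', w.le w' → ∀ a ∈ w'.dom, φ.inst x a ∈ w'.theory := by
  obtain ⟨hφ, hφL⟩ := all_mem_sentences.1 hL
  refine ⟨fun h w' hw a ha => ?_, fun h => ?_⟩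
  · exact w'.sat.closed _ (inst_mem_sentences hφ (hφL.trans (dom_mono hw)) ha)
      (.mp (.thm (.univ a hφ)) (w'.sat.der (theory_mono hw h)))
  · by_contra hn
    obtain ⟨T', hT', hTT', a, ha, hφ⟩ := w.chain.exists_of_all_notMem hL hn
    exact hφ (h ⟨w.depth, w.stage + 2, T', hT'⟩ (.inr ⟨by simp, rfl, hTT'⟩) a ha)

theorem ex_mem_theory (hL : ex x φ ∈ sentences w.dom) :
    ex x φ ∈ w.theory ↔ ∃ a ∈ w.dom, φ.inst x a ∈ w.theory := by
  refine ⟨w.sat.witness x φ, fun ⟨a, _, h⟩ => ?_⟩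
  exact w.sat.closed _ hL ((Der.ex_intro a (ex_mem_sentences.1 hL).1).mp (w.sat.der h))

end Theory

theorem exists_acc (w : ChainWorld (logicD σ) e) : ∃ v, w.acc v := by
  have htop : top ∈ sentences w.dom := top_mem_sentences
  have hbox : box top ∈ w.theory := w.sat.closed _ (box_mem_sentences.2 htop) (.nec .top)
  have hdia : dia top ∈ w.theory := w.sat.closed _ (dia_mem_sentences.2 htop)
    (.mp (.thm (.extra ⟨top, htop.1, rfl⟩)) (w.sat.der hbox))
  obtain ⟨v, hv, -⟩ := (dia_mem_theory htop).1 hdia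
  exact ⟨v, hv⟩

end ChainWorld

/-- The constant that interprets `c` in the canonical model; it belongs to all its domains. -/
def base (e : Numbering σ) (c : σ.Const) : σ.Const := e.symm (0, 0, c)

theorem base_injective (e : Numbering σ) : (base e).Injective := fun c d h => by
  simpa [base] using h

theorem base_mem_lang {e : Numbering σ} {k N : ℕ} (c : σ.Const) : base e c ∈ lang e k N := by
  simp [base, lang]

theorem rename_base_mem_sentences {e : Numbering σ} {k N : ℕ} {φ : Formula σ}
    (h : φ.IsSentence) : φ.rename (base e) ∈ sentences (lang e k N) := by
  refine ⟨isSentence_rename.2 h, ?_⟩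
  rw [consts_rename]
  exact Set.image_subset_iff.2 fun c _ => base_mem_lang c

/-- The canonical model of the logic `L`. -/
def canonicalModel (L : Logic σ) (e : Numbering σ) : Model σ where
  World := ChainWorld L e
  le := ChainWorld.le
  acc := ChainWorld.acc
  le_refl _ := .inl rfl
  le_trans _ _ _ := ChainWorld.le_trans
  le_antisymm _ _ := ChainWorld.le_antisymm
  fc1 _ _ _ := ChainWorld.exists_le_acc
  fc2 _ _ _ := ChainWorld.exists_acc_le
  Elem := σ.Const
  dom := ChainWorld.dom
  dom_le _ _ := ChainWorld.dom_mono
  dom_acc _ _ := ChainWorld.dom_acc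
  eqv w a b := eq (.const a) (.const b) ∈ w.theory
  eqv_dom w _ _ h := eq_mem_sentences.1 (w.sat.subset h)
  eqv_refl w _ := w.sat.eq_refl
  eqv_symm w _ _ := w.sat.eq_symm
  eqv_trans w _ _ _ := w.sat.eq_trans
  eqv_le _ _ _ _ h h' := ChainWorld.theory_mono h h'
  cst := base e
  cst_mem c _ := base_mem_lang c
  rel w P := {a | rel P (fun i => .const (a i)) ∈ w.theory}
  rel_dom w _ _ ha i := (w.sat.subset ha).2 (Set.mem_iUnion.2 ⟨i, rfl⟩)
  rel_le _ _ _ h _ ha := ChainWorld.theory_mono h ha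
  rel_eqv w _ _ _ := w.sat.rel_mem_of_eq_mem

/-! ### Truth in the canonical model -/

namespace Model.IsAssignment

variable {M : Model σ} {w w' v : M.World} {g : ℕ → M.Elem}

theorem mono (hg : M.IsAssignment w g) (h : M.le w w') : M.IsAssignment w' g :=
  fun x => M.dom_le w w' h (hg x)

theorem acc (hg : M.IsAssignment w g) (h : M.acc w v) : M.IsAssignment v g :=
  fun x => M.dom_acc w v h (hg x)

theorem update (hg : M.IsAssignment w g) (x : ℕ) {a : M.Elem} (ha : a ∈ M.dom w) :
    M.IsAssignment w (Function.update g x a) := fun y => by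
  rcases eq_or_ne y x with rfl | hy
  · rwa [Function.update_self]
  · rw [Function.update_of_ne hy]
    exact hg y

end Model.IsAssignment

section Truth

variable {L : Logic σ} {e : Numbering σ}

/-- The sentence that expresses `φ` under the assignment `g`, in the language in which the
elements of the canonical model name themselves. -/
def closeBy (e : Numbering σ) (g : ℕ → σ.Const) (φ : Formula σ) : Formula σ :=
  φ.close (base e) fun x => some (g x)

theorem closeBy_update (g : ℕ → σ.Const) (x : ℕ) (a : σ.Const) (φ : Formula σ) :
    closeBy e (Function.update g x a) φ =
      (φ.close (base e) (Function.update (fun x => some (g x)) x none)).inst x a := by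
  rw [inst_close _ (Function.update_self ..), Function.update_idem, closeBy]
  congr 1
  funext y
  rcases eq_or_ne y x with rfl | hy
  · simp
  · simp [hy]

theorem closeBy_of_isSentence (g : ℕ → σ.Const) {φ : Formula σ} (h : φ.IsSentence) :
    closeBy e g φ = φ.rename (base e) :=
  close_congr (fun _ _ => rfl) fun x hx => (Set.notMem_empty x (h ▸ hx)).elim

theorem closeBy_mem_sentences {w : ChainWorld L e} {g : ℕ → σ.Const}
    (hg : (canonicalModel L e).IsAssignment w g) (φ : Formula σ) :
    closeBy e g φ ∈ sentences w.dom := by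
  constructor
  · simp [IsSentence, closeBy, freeVars_close]
  · rw [closeBy, consts_close]
    refine Set.union_subset (Set.image_subset_iff.2 fun c _ => base_mem_lang c) ?_
    rintro c ⟨x, -, hx⟩
    exact Option.some.inj hx ▸ hg x

theorem close_eq_const_den (g : ℕ → σ.Const) (t : Term σ) :
    t.close (base e) (fun x => some (g x)) = .const ((canonicalModel L e).den g t) := by
  cases t <;> rfl

theorem sat_iff_closeBy_mem {w : ChainWorld L e} {g : ℕ → σ.Const}
    (hg : (canonicalModel L e).IsAssignment w g) (φ : Formula σ) :
    (canonicalModel L e).Sat w g φ ↔ closeBy e g φ ∈ w.theory := by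
  induction φ generalizing w g with
  | rel P ts =>
    simp only [closeBy, close, close_eq_const_den (L := L)]
    rfl
  | eq s t =>
    simp only [closeBy, close, close_eq_const_den (L := L)]
    rfl
  | bot => exact ⟨False.elim, w.sat.consistent⟩
  | and φ ψ ihφ ihψ => exact (and_congr (ihφ hg) (ihψ hg)).trans w.sat.and_mem.symm
  | or φ ψ ihφ ihψ =>
    exact (or_congr (ihφ hg) (ihψ hg)).trans
      (w.sat.or_mem (closeBy_mem_sentences hg (.or φ ψ))).symm
  | imp φ ψ ihφ ihψ =>
    refine Iff.trans ?_ (ChainWorld.imp_mem_theory (closeBy_mem_sentences hg (.imp φ ψ))).symm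
    exact forall₂_congr fun w' hw => imp_congr (ihφ (hg.mono hw)) (ihψ (hg.mono hw))
  | box φ ih =>
    refine Iff.trans ?_ (ChainWorld.box_mem_theory (closeBy_mem_sentences hg φ)).symm
    exact forall₄_congr fun w' v' hw hv => ih ((hg.mono hw).acc hv)
  | dia φ ih =>
    refine Iff.trans ?_ (ChainWorld.dia_mem_theory (closeBy_mem_sentences hg φ)).symm
    exact exists_congr fun v => and_congr_right fun hv => ih (hg.acc hv)
  | all x φ ih =>
    refine Iff.trans ?_ (ChainWorld.all_mem_theory (closeBy_mem_sentences hg (.all x φ))).symm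
    refine forall₄_congr fun w' hw a ha => ?_
    exact closeBy_update g x a φ ▸ ih ((hg.mono hw).update x ha)
  | ex x φ ih =>
    refine Iff.trans ?_ (ChainWorld.ex_mem_theory (closeBy_mem_sentences hg (.ex x φ))).symm
    refine exists_congr fun a => and_congr_right fun ha => ?_
    exact closeBy_update g x a φ ▸ ih (hg.update x ha)

theorem trueAt_iff_mem {w : ChainWorld L e} {φ : Formula σ} (h : φ.IsSentence) :
    (canonicalModel L e).TrueAt w φ ↔ φ.rename (base e) ∈ w.theory := by
  constructor
  · intro htrue
    obtain ⟨c⟩ := (inferInstance : Nonempty σ.Const)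
    have hg : (canonicalModel L e).IsAssignment w fun _ => base e c := fun _ => base_mem_lang c
    rw [← closeBy_of_isSentence _ h]
    exact (sat_iff_closeBy_mem hg φ).1 (htrue _ hg)
  · intro hmem g hg
    exact (sat_iff_closeBy_mem hg φ).2 (closeBy_of_isSentence (e := e) g h ▸ hmem)

theorem ChainWorld.exists_of_not_der (L : Logic σ) (e : Numbering σ) {Γ : Set (Formula σ)}
    {φ : Formula σ} (hΓ : ∀ γ ∈ Γ, γ.IsSentence) (hφ : φ.IsSentence) (h : ¬ Der L Γ φ) :
    ∃ w : ChainWorld L e, (∀ γ ∈ Γ, γ.rename (base e) ∈ w.theory) ∧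
      φ.rename (base e) ∉ w.theory := by
  have hsub {γ : Formula σ} (hγ : γ.IsSentence) :
      γ.rename (base e) ∈ sentences (lang e 0 1 \ layer e 0 1) :=
    sentences_mono (lang_subset_sdiff_layer zero_lt_one) (rename_base_mem_sentences (N := 0) hγ)
  have hΓ' : Formula.rename (base e) '' Γ ⊆ sentences (lang e 0 1 \ layer e 0 1) :=
    Set.image_subset_iff.2 fun γ hγ => hsub (hΓ γ hγ)
  have hO := OmitIdeal.below (hΓ'.trans (sentences_mono (Set.sdiff_subset_compl _ _))) (hsub hφ)
    ((Der.rename_iff (base_injective e)).not.2 h)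
  obtain ⟨U, hU, hΓU, hUO⟩ :=
    exists_saturated layer_subset_lang layer_infinite hΓ' hO.toOmitSet hO.proper
  refine ⟨⟨0, 1, fun _ => U, fun i hi => ?_, fun i hi => absurd hi i.not_lt_zero⟩,
    fun γ hγ => hΓU ⟨γ, hγ, rfl⟩, fun hφU => ?_⟩
  · rwa [Nat.le_zero.1 hi]
  · exact hUO.omits _ ⟨rename_base_mem_sentences hφ, .imp_self (isSentence_rename.2 hφ)⟩
      (hU.der hφU)

end Truth

end FOFS

theorem mainTheorem5_general {σ : FOFS.Signature.{u}} (L : FOFS.Logic σ)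
    {C : FOFS.Frame.{u} → Prop} (hC : ∀ e, C (FOFS.canonicalModel L e).toFrame)
    {Γ : Set (FOFS.Formula σ)} {φ : FOFS.Formula σ} (hΓ : ∀ γ ∈ Γ, γ.IsSentence)
    (hφ : φ.IsSentence) (h : FOFS.Entails C Γ φ) : FOFS.Derives L.extra Γ φ := by
  obtain ⟨e⟩ : Nonempty (FOFS.Numbering σ) := nonempty_equiv_of_countable
  rw [FOFS.derives_iff_der hΓ]
  by_contra hn
  obtain ⟨w, hw, hwφ⟩ := FOFS.ChainWorld.exists_of_not_der L e hΓ hφ hn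
  have hΓw : ∀ γ ∈ Γ, (FOFS.canonicalModel L e).TrueAt w γ := fun γ hγ =>
    (FOFS.trueAt_iff_mem (hΓ γ hγ)).2 (hw γ hγ)
  exact hwφ ((FOFS.trueAt_iff_mem hφ).1 (h (FOFS.canonicalModel L e) (hC e) w hΓw))

theorem mainTheorem5 (σ : FOFS.Signature.{u}) (Γ : Set (FOFS.Formula σ)) (φ : FOFS.Formula σ)
    (hΓ : ∀ γ ∈ Γ, γ.IsSentence) (hφ : φ.IsSentence)
    (h : FOFS.Entails FOFS.Frame.Serial Γ φ) :
    FOFS.Derives (FOFS.axiomD σ) Γ φ :=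
  mainTheorem5_general (FOFS.logicD σ) (fun _ => FOFS.ChainWorld.exists_acc) hΓ hφ h
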